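/- Let $r>0$, $q=e^{-\pi\sqrt r}$, and let $k_r\in(0,1)$ be the modulus determined by $K'/K=\sqrt r$, where $K=K(k_r)$ and $K'=K\big(\sqrt{1-k_r^2}\big)$ are complete elliptic integrals of the first kind, $K(k)=\int_0^{\pi/2}(1-k^2\sin^2 t)^{-1/2}\,dt$. Let $\mathrm{nd}(q,\theta)=1/\mathrm{dn}$, $\mathrm{sd}(q,\theta)=\mathrm{sn}/\mathrm{dn}$ and $\mathrm{cd}(q,\theta)=\mathrm{cn}/\mathrm{dn}$ be the Jacobi elliptic functions of modulus $k_r$ at the argument $\theta$, and let $$\mathrm{cd}_1(q,\theta)=\frac{2\pi}{Kk_r}\sum_{n=0}^{\infty}\frac{(-1)^nq^{n+1/2}\cos\left((2n+3)\frac{\pi\theta}{2K}\right)}{1-q^{2n+1}}.$$ For real $\theta$ put $a=a(\theta)=i\,q^{1/2}e^{i\pi\theta/(2K)}$, $(z;q)_\infty=\prod_{n\ge 0}(1-zq^n)$, and $$P=\left(\frac{(-a;q)_\infty}{(a;q)_\infty}\right)^2,\qquad u_0=\frac{P-1}{P+1}.$$ Then for every real $\theta$: $P\neq 0$, $\mathrm{nd}(q,\theta)+k_r\,\mathrm{sd}(q,\theta)>0$,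 and $$\mathrm{Re}\,\log P=-\log\big(\mathrm{nd}(q,\theta)+k_r\,\mathrm{sd}(q,\theta)\big);$$ when $P\ne -1$, so that $u_0$ is defined, also $$\mathrm{Re}\,\log\left(-1+\frac{2}{1-u_0}\right)=-\log\big(\mathrm{nd}(q,\theta)+k_r\,\mathrm{sd}(q,\theta)\big).$$ Moreover, $\theta\mapsto(-a;q)_\infty/(a;q)_\infty$ has a continuous logarithm on $\mathbf R$; for every real $\theta$, every branch of this logarithm defined near $\theta$ and continuous at $\theta$ is differentiable at $\theta$, and with any such branch $$\mathrm{cd}_1(q,\theta)=\mathrm{cd}(q,\theta)\cos\left(\frac{\pi\theta}{K}\right)+2k_r^{-1}\sin\left(\frac{\pi\theta}{K}\right)\,\mathrm{Im}\left[\frac{d}{d\theta}\log\left(\frac{(-a;q)_\infty}{(a;q)_\infty}\right)\right].$$ -/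

import Mathlib

open Filter Topology

noncomputable section

/-- The incomplete elliptic integral of the first kind `F(φ, k)`, with modulus `k`. -/
def ellipticF (k φ : ℝ) : ℝ :=
  ∫ t in (0 : ℝ)..φ, 1 / √(1 - k ^ 2 * Real.sin t ^ 2)

/-- The complete elliptic integral of the first kind `K(k)`, with modulus `k`. -/
def ellipticK (k : ℝ) : ℝ := ellipticF k (Real.pi / 2)

/-- The modulus `k_r`: the number `k` in `(0, 1)` with `K'/K = √r`, where `K = K(k)` and
`K' = K(√(1 - k²))`. Since `K'/K` decreases strictly and continuously from `∞` to `0` on `(0, 1)`,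
there is exactly one such `k` for every `r > 0`. -/
def singularModulus (r : ℝ) : ℝ :=
  Classical.epsilon fun k : ℝ =>
    0 < k ∧ k < 1 ∧ ellipticK √(1 - k ^ 2) / ellipticK k = √r

/-- `K = K(k_r)`. -/
def periodK (r : ℝ) : ℝ := ellipticK (singularModulus r)

/-- The nome `q = exp(-π √r)`. -/
def nome (r : ℝ) : ℝ := Real.exp (-(Real.pi * √r))

/-- The Jacobi amplitude `am(u, k)`: the inverse function of `φ ↦ F(φ, k)`, which is a strictly
increasing bijection of the real line when `0 < k < 1`. -/
def jacobiAm (k u : ℝ) : ℝ := Function.invFun (ellipticF k) u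

/-- The Jacobi elliptic function `sn` with modulus `k`, on the real line. -/
def jacobiSn (k u : ℝ) : ℝ := Real.sin (jacobiAm k u)

/-- The Jacobi elliptic function `cn` with modulus `k`, on the real line. -/
def jacobiCn (k u : ℝ) : ℝ := Real.cos (jacobiAm k u)

/-- The Jacobi elliptic function `dn` with modulus `k`, on the real line. -/
def jacobiDn (k u : ℝ) : ℝ := √(1 - k ^ 2 * jacobiSn k u ^ 2)

/-- `nd(q, u) = 1 / dn`, for the nome `q = exp(-π √r)`, that is, for the modulus `k_r`. -/
def ellND (r u : ℝ) : ℝ := 1 / jacobiDn (singularModulus r) u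

/-- `sd(q, u) = sn / dn`, for the nome `q = exp(-π √r)`. -/
def ellSD (r u : ℝ) : ℝ :=
  jacobiSn (singularModulus r) u / jacobiDn (singularModulus r) u

/-- `cd(q, u) = cn / dn`, for the nome `q = exp(-π √r)`. -/
def ellCD (r u : ℝ) : ℝ :=
  jacobiCn (singularModulus r) u / jacobiDn (singularModulus r) u

/-- The (non-elliptic) function `cd₁(q, u)`, for the nome `q = exp(-π √r)`. -/
def ellCD1 (r u : ℝ) : ℝ :=
  2 * Real.pi / (periodK r * singularModulus r) *
    ∑' n : ℕ, (-1) ^ n * nome r ^ ((n : ℝ) + 1 / 2) *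
      Real.cos ((2 * n + 3) * (Real.pi / (2 * periodK r)) * u) / (1 - nome r ^ (2 * n + 1))

/-- The infinite product `(z; q)_∞ = ∏_{n ≥ 0} (1 - z q^n)`. -/
def qPochInf (z q : ℂ) : ℂ := ∏' n : ℕ, (1 - z * q ^ n)

/-- `a = i q^{1/2} e^{iπθ/(2K)}`. -/
def aParam (r θ : ℝ) : ℂ :=
  Complex.I * ((√(nome r) : ℝ) : ℂ) *
    Complex.exp (Complex.I * (Real.pi * θ / (2 * periodK r) : ℝ))

/-- The quotient `(-a; q)_∞ / (a; q)_∞`, as a function of `θ`. -/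
def pochQuot (r θ : ℝ) : ℂ :=
  qPochInf (-aParam r θ) (nome r) / qPochInf (aParam r θ) (nome r)

/-- `P = ((-a; q)_∞ / (a; q)_∞)²`. -/
def pochP (r θ : ℝ) : ℂ := pochQuot r θ ^ 2

/-- `u₀ = (P - 1) / (P + 1)`. -/
def uZero (r θ : ℝ) : ℂ := (pochP r θ - 1) / (pochP r θ + 1)

/-- `L` is near `θ` a branch of the logarithm of `f` that is continuous at `θ`. -/
def IsLogBranchAt (f L : ℝ → ℂ) (θ : ℝ) : Prop :=
  ContinuousAt L θ ∧ ∀ᶠ t in 𝓝 θ, Complex.exp (L t) = f t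

end

/-! The theorem is read off from theta functions at `τ = i√r`, so that `q = e^{πiτ}`.

*Elliptic functions.* A rearrangement of a double series (`theta3_mul_theta3`) expresses products
of theta functions at `τ` through theta functions at `2τ`. It yields the quadratic relations between
the `θⱼ` and, by differentiation, their Wronskians (`wronskian_theta1_theta4`,
`wronskian_theta2_theta4`). On the real line these say that the quotients `θ₁/θ₄`, `θ₂/θ₄`, `θ₃/θ₄`,
suitably normalized, form a point `(S, C)` of the unit circle which moves with angular velocity
`ω D`, where `D = √(1 - k²S²)`, `k = θ₂²/θ₃²` and `ω = θ₁'θ₃/(θ₂θ₄)`. The primitive `ψ` of `ω D`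
therefore satisfies `F(ψ(x), k) = ωx` (`ellipticF_thetaAm`), that is, `ψ` is the amplitude and
`S`, `C`, `D` are `sn`, `cn`, `dn` at `ωx`. Since `θ₂` has no zero before `1/2`, `ψ(1/2) = π/2`
and `ω = 2K`.

*The modulus.* The transformation `τ ↦ -1/τ` replaces `k` by `√(1 - k²)` and `ω` by `√r ω`, so
that `K'/K = √r`. As `K'/K` is strictly decreasing in the modulus, `k` is the singular modulus
(`singularModulus_eq`).

*The quotient of `q`-products.* By the triple product identity (`jacobiTheta₂_eq_qPochInf`) the
squared moduli of `(∓a; q)_∞` are values of `θ₃` and `θ₄` at `τ/2`, up to a common constant. Their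
squares are combinations of theta functions at `τ`, which gives
`|(-a; q)_∞/(a; q)_∞|⁴ = (1 - k sn)/(1 + k sn) = (nd + k sd)⁻²` (`norm_pochQuot_pow_four`), the
first half of the theorem. Differentiating the logarithm of this identity shows that the real part
of the logarithmic derivative of the quotient is `-(k/2) cd`. On the other hand the quotient has
the logarithm `∑ 2a^{2m+1}/((2m+1)(1 - q^{2m+1}))` (`exp_lambertLog`), whose termwise derivative has
as real and imaginary parts, up to a constant factor, the series of `cd₁` with `cos (2m+1)x` and
`sin (2m+1)x` in place of `cos (2m+3)x`, where `x = πθ/(2K)`. The addition theorem for the cosine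
combines the two into the formula for `cd₁`.
-/

noncomputable section

open scoped Real

section

open Complex

/-! ### The four theta functions -/

/-- The theta function `θ₃(z | τ) = ∑ q^{n²} e^{2πinz}`, `q = e^{πiτ}`, in the normalization where
`1` and `τ` are the (quasi-)periods of `θ₃`. -/
def theta3 (z τ : ℂ) : ℂ := jacobiTheta₂ z τ

/-- The theta function `θ₄(z | τ) = θ₃(z + 1/2 | τ)`. -/
def theta4 (z τ : ℂ) : ℂ := jacobiTheta₂ (z + 1 / 2) τ

/-- The theta function `θ₂(z | τ) = ∑ q^{(n + 1/2)²} e^{πi(2n + 1)z}`, written through `θ₃`. -/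
def theta2 (z τ : ℂ) : ℂ := cexp (π * I * τ / 4 + π * I * z) * jacobiTheta₂ (z + τ / 2) τ

/-- The odd theta function `θ₁(z | τ) = -θ₂(z + 1/2 | τ)`. -/
def theta1 (z τ : ℂ) : ℂ := -theta2 (z + 1 / 2) τ

lemma theta3_add_half (z τ : ℂ) : theta3 (z + 1 / 2) τ = theta4 z τ := rfl

lemma theta4_add_half (z τ : ℂ) : theta4 (z + 1 / 2) τ = theta3 z τ := by
  rw [theta4, theta3, ← jacobiTheta₂_add_left z, add_assoc]; norm_num

lemma theta2_add_half (z τ : ℂ) : theta2 (z + 1 / 2) τ = -theta1 z τ := by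
  rw [theta1, neg_neg]

lemma theta2_add_one (z τ : ℂ) : theta2 (z + 1) τ = -theta2 z τ := by
  rw [theta2, theta2, show z + 1 + τ / 2 = z + τ / 2 + 1 by ring, jacobiTheta₂_add_left,
    show π * I * τ / 4 + π * I * (z + 1) = π * I * τ / 4 + π * I * z + π * I by ring,
    Complex.exp_add _ (π * I), exp_pi_mul_I]
  ring

lemma theta1_add_half (z τ : ℂ) : theta1 (z + 1 / 2) τ = theta2 z τ := by
  rw [theta1, show z + 1 / 2 + 1 / 2 = z + 1 by ring, theta2_add_one, neg_neg]

lemma theta4_neg (z τ : ℂ) : theta4 (-z) τ = theta4 z τ := by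
  rw [theta4, theta4, ← jacobiTheta₂_neg_left, ← jacobiTheta₂_add_left]; ring_nf

lemma theta2_neg (z τ : ℂ) : theta2 (-z) τ = theta2 z τ := by
  have h : jacobiTheta₂ (z + τ / 2) τ = cexp (-2 * π * I * z) * jacobiTheta₂ (-z + τ / 2) τ := by
    rw [← jacobiTheta₂_neg_left (-z + τ / 2), show z + τ / 2 = -(-z + τ / 2) + τ by ring,
      jacobiTheta₂_add_left']
    ring_nf
  rw [theta2, theta2, h, ← mul_assoc, ← Complex.exp_add]
  ring_nf

lemma theta1_neg (z τ : ℂ) : theta1 (-z) τ = -theta1 z τ := by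
  rw [theta1, theta1, ← theta2_neg, ← theta2_add_one]; ring_nf

@[simp] lemma theta1_zero (τ : ℂ) : theta1 0 τ = 0 := by
  have h := theta1_neg 0 τ
  rw [neg_zero] at h
  exact self_eq_neg.mp h

lemma differentiable_theta3 {τ : ℂ} (hτ : 0 < τ.im) : Differentiable ℂ (theta3 · τ) :=
  fun z ↦ differentiableAt_jacobiTheta₂_fst z hτ

lemma differentiable_theta4 {τ : ℂ} (hτ : 0 < τ.im) : Differentiable ℂ (theta4 · τ) :=
  (differentiable_theta3 hτ).comp (differentiable_id.add_const (1 / 2))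

lemma differentiable_theta2 {τ : ℂ} (hτ : 0 < τ.im) : Differentiable ℂ (theta2 · τ) := by
  have h : Differentiable ℂ fun z ↦ theta3 (z + τ / 2) τ :=
    (differentiable_theta3 hτ).comp (differentiable_id.add_const (τ / 2))
  unfold theta2
  exact Differentiable.mul (by fun_prop) h

lemma differentiable_theta1 {τ : ℂ} (hτ : 0 < τ.im) : Differentiable ℂ (theta1 · τ) :=
  ((differentiable_theta2 hτ).comp (differentiable_id.add_const (1 / 2))).neg

/-! ### Doubling formulas -/

/-- The splitting of pairs of integers by the common parity of sum and difference:
`(m, n) = (a + b, a - b)` or `(m, n) = (a + b + 1, a - b)`. -/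
def sumDiffEquiv : (ℤ × ℤ) ⊕ (ℤ × ℤ) ≃ ℤ × ℤ :=
  Equiv.ofBijective
    (Sum.elim (fun x ↦ (x.1 + x.2, x.1 - x.2)) (fun x ↦ (x.1 + x.2 + 1, x.1 - x.2))) <| by
    constructor
    · rintro (⟨a, b⟩ | ⟨a, b⟩) (⟨c, d⟩ | ⟨c, d⟩) h <;>
        simp only [Sum.elim_inl, Sum.elim_inr, Prod.mk.injEq] at h
      · rw [show a = c by omega, show b = d by omega]
      · omega
      · omega
      · rw [show a = c by omega, show b = d by omega]
    · rintro ⟨m, n⟩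
      rcases Int.even_or_odd' (m + n) with ⟨s, hs | hs⟩
      · refine ⟨Sum.inl (s, m - s), ?_⟩
        simp only [Sum.elim_inl, Prod.mk.injEq]
        omega
      · refine ⟨Sum.inr (s, m - s - 1), ?_⟩
        simp only [Sum.elim_inr, Prod.mk.injEq]
        omega

/-- The general term of the product of two theta series. -/
def thetaPairTerm (z w τ : ℂ) (x : ℤ × ℤ) : ℂ :=
  jacobiTheta₂_term x.1 z τ * jacobiTheta₂_term x.2 w τ

lemma hasSum_thetaPairTerm (z w : ℂ) {τ : ℂ} (hτ : 0 < τ.im) :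
    HasSum (thetaPairTerm z w τ) (jacobiTheta₂ z τ * jacobiTheta₂ w τ) := by
  have h1 := (summable_jacobiTheta₂_term_iff z τ).2 hτ
  have h2 := (summable_jacobiTheta₂_term_iff w τ).2 hτ
  have h3 := summable_mul_of_summable_norm h1.norm h2.norm
  have h4 := tsum_mul_tsum_of_summable_norm h1.norm h2.norm
  rw [jacobiTheta₂, jacobiTheta₂, h4]
  exact h3.hasSum

/-- The product of two theta functions as a combination of theta functions of `2τ`: in the double
series, sum and difference of the two indices decouple once their common parity is fixed. -/
lemma theta3_mul_theta3 (z w : ℂ) {τ : ℂ} (hτ : 0 < τ.im) :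
    theta3 (z + w) τ * theta3 (z - w) τ =
      theta3 (2 * z) (2 * τ) * theta3 (2 * w) (2 * τ) +
        theta2 (2 * z) (2 * τ) * theta2 (2 * w) (2 * τ) := by
  have h2τ : 0 < (2 * τ).im := by simpa using hτ
  have h0 := sumDiffEquiv.hasSum_iff.2 (hasSum_thetaPairTerm (z + w) (z - w) hτ)
  have he := hasSum_thetaPairTerm (2 * z) (2 * w) h2τ
  have ho := (hasSum_thetaPairTerm (2 * z + 2 * τ / 2) (2 * w + 2 * τ / 2) h2τ).mul_left
    (cexp (π * I * (2 * τ) / 4 + π * I * (2 * z)) * cexp (π * I * (2 * τ) / 4 + π * I * (2 * w)))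
  rw [mul_mul_mul_comm (cexp _) (cexp _)] at ho
  refine h0.unique (HasSum.sum ?_ ?_)
  · refine (congrArg (HasSum · _) (funext ?_)).mpr he
    rintro ⟨a, b⟩
    change thetaPairTerm _ _ _ (a + b, a - b) = _
    simp only [thetaPairTerm, jacobiTheta₂_term, ← Complex.exp_add]
    push_cast
    ring_nf
  · refine (congrArg (HasSum · _) (funext ?_)).mpr ho
    rintro ⟨a, b⟩
    change thetaPairTerm _ _ _ (a + b + 1, a - b) = _
    simp only [thetaPairTerm, jacobiTheta₂_term, ← Complex.exp_add]
    push_cast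
    ring_nf

lemma theta4_mul_theta3 (z w : ℂ) {τ : ℂ} (hτ : 0 < τ.im) :
    theta4 (z + w) τ * theta3 (z - w) τ =
      theta4 (2 * z) (2 * τ) * theta4 (2 * w) (2 * τ) +
        theta1 (2 * z) (2 * τ) * theta1 (2 * w) (2 * τ) := by
  have h := theta3_mul_theta3 (z + 1 / 4) (w + 1 / 4) hτ
  rw [show z + 1 / 4 + (w + 1 / 4) = z + w + 1 / 2 by ring,
    show z + 1 / 4 - (w + 1 / 4) = z - w by ring, show 2 * (z + 1 / 4) = 2 * z + 1 / 2 by ring,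
    show 2 * (w + 1 / 4) = 2 * w + 1 / 2 by ring] at h
  simp only [theta3_add_half, theta2_add_half] at h
  rw [h]; ring

lemma theta3_sq (z : ℂ) {τ : ℂ} (hτ : 0 < τ.im) :
    theta3 z τ ^ 2 = theta3 0 (2 * τ) * theta3 (2 * z) (2 * τ) +
      theta2 0 (2 * τ) * theta2 (2 * z) (2 * τ) := by
  have h := theta3_mul_theta3 z 0 hτ
  simp only [add_zero, sub_zero, mul_zero] at h
  rw [sq, h]; ring

lemma theta4_sq (z : ℂ) {τ : ℂ} (hτ : 0 < τ.im) :
    theta4 z τ ^ 2 = theta3 0 (2 * τ) * theta3 (2 * z) (2 * τ) -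
      theta2 0 (2 * τ) * theta2 (2 * z) (2 * τ) := by
  have h := theta3_sq (z + 1 / 2) hτ
  rw [theta3_add_half, show 2 * (z + 1 / 2) = 2 * z + 1 by ring, theta2_add_one, theta3,
    theta3, jacobiTheta₂_add_left] at h
  rw [h, theta3, theta3]; ring

lemma theta4_mul_theta3_self (z : ℂ) {τ : ℂ} (hτ : 0 < τ.im) :
    theta4 z τ * theta3 z τ = theta4 0 (2 * τ) * theta4 (2 * z) (2 * τ) := by
  have h := theta4_mul_theta3 z 0 hτ
  simp only [add_zero, sub_zero, mul_zero, theta1_zero] at h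
  rw [h]; ring

/-! ### Quadratic relations -/

lemma theta4_theta3_theta2_sq (v : ℂ) {τ : ℂ} (hτ : 0 < τ.im) :
    theta4 0 τ ^ 2 * theta4 v τ ^ 2 =
      theta3 0 τ ^ 2 * theta3 v τ ^ 2 - theta2 0 τ ^ 2 * theta2 v τ ^ 2 := by
  have hτ2 : 0 < (τ / 2).im := by simpa using hτ
  have h1 := theta4_mul_theta3_self (v / 2) hτ2
  have h2 := theta3_sq (v / 2) hτ2
  have h3 := theta4_sq (v / 2) hτ2
  simp only [mul_div_cancel₀ _ (two_ne_zero' ℂ)] at h1 h2 h3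
  linear_combination (-(theta4 (v / 2) (τ / 2) * theta3 (v / 2) (τ / 2)) -
    theta4 0 τ * theta4 v τ) * h1 + theta4 (v / 2) (τ / 2) ^ 2 * h2 +
    (theta3 0 τ * theta3 v τ + theta2 0 τ * theta2 v τ) * h3

lemma theta3_theta4_theta1_sq (v : ℂ) {τ : ℂ} (hτ : 0 < τ.im) :
    theta4 0 τ ^ 2 * theta3 v τ ^ 2 =
      theta3 0 τ ^ 2 * theta4 v τ ^ 2 - theta2 0 τ ^ 2 * theta1 v τ ^ 2 := by
  have h := theta4_theta3_theta2_sq (v + 1 / 2) hτ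
  rw [theta4_add_half, theta3_add_half, theta2_add_half] at h
  linear_combination h

/-- Jacobi's identity `θ₃⁴ = θ₂⁴ + θ₄⁴` between theta constants. -/
lemma theta_const_quartic {τ : ℂ} (hτ : 0 < τ.im) :
    theta3 0 τ ^ 4 = theta2 0 τ ^ 4 + theta4 0 τ ^ 4 := by
  have h := theta4_theta3_theta2_sq 0 hτ
  linear_combination -h

/-! ### Wronskians -/

lemma deriv_theta4_zero (τ : ℂ) : deriv (theta4 · τ) 0 = 0 := by
  have h : (fun z ↦ theta4 (-z) τ) = (theta4 · τ) := funext fun z ↦ theta4_neg z τ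
  have h1 := deriv_comp_neg (f := (theta4 · τ)) (x := (0 : ℂ))
  rw [h, neg_zero] at h1
  exact self_eq_neg.mp h1

/-- The Wronskian of `θ₃` and `θ₄` is a multiple of `θ₁` at the doubled argument and period ratio:
differentiate the product formula for `θ₄(z + w) θ₃(z - w)` in `w` at `w = 0`. -/
lemma wronskian_theta4_theta3 (z : ℂ) {τ : ℂ} (hτ : 0 < τ.im) :
    deriv (theta4 · τ) z * theta3 z τ - theta4 z τ * deriv (theta3 · τ) z =
      2 * deriv (theta1 · (2 * τ)) 0 * theta1 (2 * z) (2 * τ) := by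
  have h2τ : 0 < (2 * τ).im := by simpa using hτ
  have hp : HasDerivAt (fun w : ℂ ↦ z + w) 1 0 := (hasDerivAt_id _).const_add z
  have hm : HasDerivAt (fun w : ℂ ↦ z - w) (-1) 0 := (hasDerivAt_id _).const_sub z
  have hd : HasDerivAt (fun w : ℂ ↦ 2 * w) 2 0 := by
    simpa using (hasDerivAt_id (0 : ℂ)).const_mul 2
  have d4 : HasDerivAt (theta4 · τ) (deriv (theta4 · τ) z) (z + 0) := by
    rw [add_zero]; exact (differentiable_theta4 hτ z).hasDerivAt
  have d3 : HasDerivAt (theta3 · τ) (deriv (theta3 · τ) z) (z - 0) := by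
    rw [sub_zero]; exact (differentiable_theta3 hτ z).hasDerivAt
  have e4 : HasDerivAt (theta4 · (2 * τ)) (deriv (theta4 · (2 * τ)) 0) (2 * 0) := by
    rw [mul_zero]; exact (differentiable_theta4 h2τ 0).hasDerivAt
  have e1 : HasDerivAt (theta1 · (2 * τ)) (deriv (theta1 · (2 * τ)) 0) (2 * 0) := by
    rw [mul_zero]; exact (differentiable_theta1 h2τ 0).hasDerivAt
  have hl := (d4.comp 0 hp).mul (d3.comp 0 hm)
  have hr := ((e4.comp 0 hd).const_mul (theta4 (2 * z) (2 * τ))).add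
    ((e1.comp 0 hd).const_mul (theta1 (2 * z) (2 * τ)))
  have hlr := hl.unique (hr.congr_of_eventuallyEq
    (Eventually.of_forall fun w ↦ theta4_mul_theta3 z w hτ))
  simp only [Function.comp, add_zero, sub_zero, deriv_theta4_zero] at hlr
  linear_combination hlr

lemma wronskian_theta2_theta3 (v : ℂ) {τ : ℂ} (hτ : 0 < τ.im) :
    theta2 0 τ * theta3 0 τ *
        (deriv (theta2 · τ) v * theta3 v τ - theta2 v τ * deriv (theta3 · τ) v) =
      -(deriv (theta1 · τ) 0 * theta4 0 τ * (theta1 v τ * theta4 v τ)) := by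
  have hτ2 : 0 < (τ / 2).im := by simpa using hτ
  have hd : HasDerivAt (fun w : ℂ ↦ w / 2) (1 / 2) v := (hasDerivAt_id v).div_const 2
  have d3 := (differentiable_theta3 hτ v).hasDerivAt
  have d2 := (differentiable_theta2 hτ v).hasDerivAt
  have p3 := ((differentiable_theta3 hτ2 (v / 2)).hasDerivAt.comp v hd)
  have p4 := ((differentiable_theta4 hτ2 (v / 2)).hasDerivAt.comp v hd)
  -- Differentiate `θ₃² = a X + b Y` and `θ₄² = a X - b Y`, which express the squares at `τ / 2`
  -- through `X = θ₃` and `Y = θ₂` at `τ`.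
  have h3 := (p3.pow 2).unique (((d3.const_mul (theta3 0 τ)).add
    (d2.const_mul (theta2 0 τ))).congr_of_eventuallyEq (Eventually.of_forall fun w ↦ by
      simpa [mul_div_cancel₀] using theta3_sq (w / 2) hτ2))
  have h4 := (p4.pow 2).unique (((d3.const_mul (theta3 0 τ)).sub
    (d2.const_mul (theta2 0 τ))).congr_of_eventuallyEq (Eventually.of_forall fun w ↦ by
      simpa [mul_div_cancel₀] using theta4_sq (w / 2) hτ2))
  have s3 := theta3_sq (v / 2) hτ2
  have s4 := theta4_sq (v / 2) hτ2
  have m34 := theta4_mul_theta3_self (v / 2) hτ2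
  have w34 := wronskian_theta4_theta3 (v / 2) hτ2
  simp only [mul_div_cancel₀ _ (two_ne_zero' ℂ), Function.comp, Nat.cast_ofNat,
    Nat.add_one_sub_one, pow_one] at *
  set A := theta3 (v / 2) (τ / 2)
  set B := theta4 (v / 2) (τ / 2)
  set A' := deriv (theta3 · (τ / 2)) (v / 2)
  set B' := deriv (theta4 · (τ / 2)) (v / 2)
  set X := theta3 v τ
  set Y := theta2 v τ
  set X' := deriv (theta3 · τ) v
  set Y' := deriv (theta2 · τ) v
  set a := theta3 0 τ
  set b := theta2 0 τ
  linear_combination (1 / 2) * (-(A * A') * s4 - (a * X - b * Y) * h3 + A ^ 2 * h4 +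
    (a * X' - b * Y') * s3 - A * B * w34 - 2 * deriv (theta1 · τ) 0 * theta1 v τ * m34)

lemma wronskian_theta1_theta4 (v : ℂ) {τ : ℂ} (hτ : 0 < τ.im) :
    theta2 0 τ * theta3 0 τ *
        (deriv (theta1 · τ) v * theta4 v τ - theta1 v τ * deriv (theta4 · τ) v) =
      deriv (theta1 · τ) 0 * theta4 0 τ * (theta2 v τ * theta3 v τ) := by
  have h := wronskian_theta2_theta3 (v + 1 / 2) hτ
  have h1 : deriv (theta1 · τ) v = -deriv (theta2 · τ) (v + 1 / 2) := by
    rw [← deriv_comp_add_const, ← deriv.neg]; rfl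
  have h4 : deriv (theta4 · τ) v = deriv (theta3 · τ) (v + 1 / 2) := by
    rw [← deriv_comp_add_const]; rfl
  rw [theta3_add_half, theta2_add_half, theta4_add_half, theta1_add_half] at h
  rw [h1, h4]
  linear_combination -h

/-! ### The translation `τ ↦ τ + 1` -/

lemma jacobiTheta₂_add_one_right (z τ : ℂ) :
    jacobiTheta₂ z (τ + 1) = jacobiTheta₂ (z + 1 / 2) τ := by
  refine tsum_congr fun n ↦ ?_
  -- the two exponents differ by `π i n (n - 1)`, and `n (n - 1)` is even
  obtain ⟨m, hm⟩ : Even ((n - 1) * (n - 1 + 1)) := Int.even_mul_succ_self (n - 1)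
  have hm' : ((n : ℂ) - 1) * n = m + m := by
    have := congrArg (Int.cast : ℤ → ℂ) hm
    push_cast at this
    linear_combination this
  rw [jacobiTheta₂_term, jacobiTheta₂_term]
  calc _ = cexp (2 * π * I * n * (z + 1 / 2) + π * I * n ^ 2 * τ + m * (2 * π * I)) := by
        congr 1
        linear_combination π * I * hm'
    _ = _ := by rw [Complex.exp_add _ (m * (2 * π * I)), exp_int_mul_two_pi_mul_I, mul_one]

lemma theta4_add_one_right (z τ : ℂ) : theta4 z (τ + 1) = theta3 z τ := by
  rw [theta4, jacobiTheta₂_add_one_right]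
  exact theta4_add_half z τ

lemma theta3_add_one_right (z τ : ℂ) : theta3 z (τ + 1) = theta4 z τ :=
  jacobiTheta₂_add_one_right z τ

lemma theta2_add_one_right (z τ : ℂ) :
    theta2 z (τ + 1) = cexp (π * I / 4) * theta2 z τ := by
  rw [theta2, theta2, jacobiTheta₂_add_one_right,
    show z + (τ + 1) / 2 + 1 / 2 = z + τ / 2 + 1 by ring, jacobiTheta₂_add_left, ← mul_assoc,
    ← Complex.exp_add]
  ring_nf

lemma theta1_add_one_right (z τ : ℂ) :
    theta1 z (τ + 1) = cexp (π * I / 4) * theta1 z τ := by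
  rw [theta1, theta2_add_one_right, theta1]; ring

lemma wronskian_theta2_theta4 (v : ℂ) {τ : ℂ} (hτ : 0 < τ.im) :
    theta2 0 τ * theta4 0 τ *
        (deriv (theta2 · τ) v * theta4 v τ - theta2 v τ * deriv (theta4 · τ) v) =
      -(deriv (theta1 · τ) 0 * theta3 0 τ * (theta1 v τ * theta3 v τ)) := by
  have h := wronskian_theta2_theta3 v (τ := τ + 1) (by simpa using hτ)
  simp only [theta3_add_one_right, theta4_add_one_right, theta2_add_one_right,
    theta1_add_one_right, deriv_const_mul_field] at h
  refine mul_left_cancel₀ (pow_ne_zero 2 (Complex.exp_ne_zero (π * I / 4))) ?_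
  linear_combination h

/-! ### The modular transformation `τ ↦ -1/τ` -/

/-- The automorphy factor in the transformation of the theta functions under `τ ↦ -1/τ`. -/
def thetaFactor (z τ : ℂ) : ℂ := 1 / (-I * τ) ^ (1 / 2 : ℂ) * cexp (-π * I * z ^ 2 / τ)

lemma thetaFactor_ne_zero (z : ℂ) {τ : ℂ} (hτ : τ ≠ 0) : thetaFactor z τ ≠ 0 := by
  refine mul_ne_zero (one_div_ne_zero ?_) (Complex.exp_ne_zero _)
  simp [Complex.cpow_eq_zero_iff, hτ]

lemma theta3_modular (z τ : ℂ) : theta3 z τ = thetaFactor z τ * theta3 (z / τ) (-1 / τ) :=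
  jacobiTheta₂_functional_equation z τ

lemma theta2_modular (z : ℂ) {τ : ℂ} (hτ : τ ≠ 0) :
    theta2 z τ = thetaFactor z τ * theta4 (z / τ) (-1 / τ) := by
  have h : cexp (-π * I * z ^ 2 / τ) =
      cexp (π * I * τ / 4 + π * I * z) * cexp (-π * I * (z + τ / 2) ^ 2 / τ) := by
    rw [← Complex.exp_add]
    congr 1
    field_simp
    ring
  rw [theta2, jacobiTheta₂_functional_equation, theta4, thetaFactor, h, add_div,
    show τ / 2 / τ = 1 / 2 by field_simp]
  ring

lemma theta4_modular (z : ℂ) {τ : ℂ} (hτ : τ ≠ 0) :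
    theta4 z τ = thetaFactor z τ * theta2 (z / τ) (-1 / τ) := by
  have h : cexp (-π * I * (z + 1 / 2) ^ 2 / τ) =
      cexp (-π * I * z ^ 2 / τ) * cexp (π * I * (-1 / τ) / 4 + π * I * -(z / τ)) := by
    rw [← Complex.exp_add]
    congr 1
    field_simp
    ring
  rw [theta4, jacobiTheta₂_functional_equation, ← theta2_neg, theta2, thetaFactor, h,
    ← jacobiTheta₂_neg_left, show -((z + 1 / 2) / τ) = -(z / τ) + -1 / τ / 2 by field_simp; ring]
  ring

lemma theta1_modular (z : ℂ) {τ : ℂ} (hτ : τ ≠ 0) :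
    theta1 z τ = I * thetaFactor z τ * theta1 (z / τ) (-1 / τ) := by
  have h : cexp (-π * I * (z + 1 / 2) ^ 2 / τ) = cexp (-π * I * z ^ 2 / τ) *
      (-I * cexp (π * I * (-1 / τ) / 4 + π * I * (-(z / τ) + 1 / 2))) := by
    have h1 : -I = cexp (-(π / 2 * I)) := by
      rw [Complex.exp_neg, exp_pi_div_two_mul_I, inv_I]
    rw [h1, ← Complex.exp_add, ← Complex.exp_add]
    congr 1
    field_simp
    ring
  rw [theta1, theta2_modular _ hτ, theta4, thetaFactor, h, ← neg_neg (theta1 (z / τ) (-1 / τ)),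
    ← theta1_neg, theta1, theta2, thetaFactor, ← jacobiTheta₂_neg_left,
    ← jacobiTheta₂_add_left (-((z + 1 / 2) / τ + 1 / 2)),
    show -((z + 1 / 2) / τ + 1 / 2) + 1 = -(z / τ) + 1 / 2 + -1 / τ / 2 by field_simp; ring]
  ring

lemma deriv_theta1_zero_modular {τ : ℂ} (hτ : 0 < τ.im) :
    deriv (theta1 · τ) 0 = I * thetaFactor 0 τ / τ * deriv (theta1 · (-1 / τ)) 0 := by
  have hτ0 : τ ≠ 0 := by rintro rfl; simp at hτ
  have hτ' : 0 < (-1 / τ).im := by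
    rw [neg_div, neg_im, one_div, inv_im, neg_div, neg_neg]
    exact div_pos hτ (normSq_pos.2 hτ0)
  have hf : DifferentiableAt ℂ (thetaFactor · τ) 0 := by unfold thetaFactor; fun_prop
  have hd : HasDerivAt (fun z : ℂ ↦ z / τ) (1 / τ) 0 := (hasDerivAt_id _).div_const τ
  have h1 : HasDerivAt (theta1 · (-1 / τ)) (deriv (theta1 · (-1 / τ)) 0) (0 / τ) := by
    rw [zero_div]; exact (differentiable_theta1 hτ' 0).hasDerivAt
  have h := ((hf.hasDerivAt.const_mul I).mul (h1.comp 0 hd)).congr_of_eventuallyEq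
    (Eventually.of_forall fun z ↦ theta1_modular z hτ0)
  rw [h.deriv]
  simp only [Function.comp, zero_div, theta1_zero]
  ring

/-! ### The triple product -/

/-- The finite Euler product `(Q; Q)_n = ∏_{i < n} (1 - Q^{i + 1})`. -/
def eulerProd (Q : ℝ) (n : ℕ) : ℝ := ∏ i ∈ Finset.range n, (1 - Q ^ (i + 1))

/-- The reciprocal `1 / (Q; Q)_m`, extended by `0` to negative `m`. -/
def eulerInv (Q : ℝ) (m : ℤ) : ℝ := if 0 ≤ m then (eulerProd Q m.toNat)⁻¹ else 0

/-- The Gaussian binomial coefficient `2N` over `N + n`, which vanishes for `|n| > N`. -/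
def gaussCoeff (Q : ℝ) (N : ℕ) (n : ℤ) : ℝ :=
  eulerProd Q (2 * N) * eulerInv Q (N + n) * eulerInv Q (N - n)

/-- The infinite Euler product `(Q; Q)_∞`. -/
def eulerLimit (Q : ℝ) : ℝ := ∏' i : ℕ, (1 + -Q ^ (i + 1))

section

variable {Q : ℝ}

lemma summable_neg_pow_succ (h0 : 0 < Q) (h1 : Q < 1) : Summable fun i : ℕ ↦ -Q ^ (i + 1) :=
  ((summable_nat_add_iff 1).2 (summable_geometric_of_lt_one h0.le h1)).neg

lemma one_sub_pow_succ_pos (h0 : 0 < Q) (h1 : Q < 1) (i : ℕ) : 0 < 1 - Q ^ (i + 1) :=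
  sub_pos.2 (pow_lt_one₀ h0.le h1 i.succ_ne_zero)

lemma eulerProd_pos (h0 : 0 < Q) (h1 : Q < 1) (n : ℕ) : 0 < eulerProd Q n :=
  Finset.prod_pos fun i _ ↦ one_sub_pow_succ_pos h0 h1 i

lemma antitone_eulerProd (h0 : 0 < Q) (h1 : Q < 1) : Antitone (eulerProd Q) := by
  refine antitone_nat_of_succ_le fun n ↦ ?_
  rw [eulerProd, Finset.prod_range_succ]
  exact mul_le_of_le_one_right (eulerProd_pos h0 h1 n).le (sub_le_self _ (by positivity))

lemma tendsto_eulerProd (h0 : 0 < Q) (h1 : Q < 1) :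
    Tendsto (eulerProd Q) atTop (𝓝 (eulerLimit Q)) := by
  have h := (Real.multipliable_one_add_of_summable
    (summable_neg_pow_succ h0 h1)).hasProd.tendsto_prod_nat
  exact h

lemma eulerLimit_pos (h0 : 0 < Q) (h1 : Q < 1) : 0 < eulerLimit Q := by
  refine lt_of_le_of_ne (ge_of_tendsto' (tendsto_eulerProd h0 h1)
    fun n ↦ (eulerProd_pos h0 h1 n).le) (Ne.symm ?_)
  exact tprod_one_add_ne_zero_of_summable
    (fun i ↦ (one_sub_pow_succ_pos h0 h1 i).ne') (summable_neg_pow_succ h0 h1).norm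

lemma eulerInv_nonneg (h0 : 0 < Q) (h1 : Q < 1) (m : ℤ) : 0 ≤ eulerInv Q m := by
  unfold eulerInv
  split_ifs
  · exact (inv_pos.2 (eulerProd_pos h0 h1 _)).le
  · rfl

lemma eulerInv_le (h0 : 0 < Q) (h1 : Q < 1) (m : ℤ) : eulerInv Q m ≤ (eulerLimit Q)⁻¹ := by
  unfold eulerInv
  split_ifs
  · exact inv_anti₀ (eulerLimit_pos h0 h1)
      ((antitone_eulerProd h0 h1).le_of_tendsto (tendsto_eulerProd h0 h1) _)
  · exact (inv_pos.2 (eulerLimit_pos h0 h1)).le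

lemma eulerInv_sub_one (h0 : 0 < Q) (h1 : Q < 1) (m : ℤ) :
    eulerInv Q (m - 1) = (1 - Q ^ m) * eulerInv Q m := by
  rcases lt_trichotomy m 0 with h | rfl | h
  · rw [eulerInv, eulerInv, if_neg (by omega), if_neg (by omega), mul_zero]
  · simp [eulerInv]
  · obtain ⟨n, rfl⟩ : ∃ n : ℕ, m = n + 1 := ⟨(m - 1).toNat, by omega⟩
    have hn := one_sub_pow_succ_pos h0 h1 n
    rw [eulerInv, eulerInv, if_pos (by omega), if_pos (by omega),
      show ((n : ℤ) + 1 - 1).toNat = n by omega, show ((n : ℤ) + 1).toNat = n + 1 by omega,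
      eulerProd, eulerProd, Finset.prod_range_succ, show (n : ℤ) + 1 = ((n + 1 : ℕ) : ℤ) by simp,
      zpow_natCast, mul_inv_rev, mul_inv_cancel_left₀ hn.ne']

/-- The recurrence of the Gaussian binomial coefficients that corresponds to the passage from `N`
to `N + 1` factors in the finite triple product. -/
lemma gaussCoeff_succ (h0 : 0 < Q) (h1 : Q < 1) (N : ℕ) (n : ℤ) :
    gaussCoeff Q (N + 1) n = (1 + Q ^ (2 * N + 1)) * gaussCoeff Q N n +
      Q ^ ((N : ℤ) + 1 - n) * gaussCoeff Q N (n - 1) +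
      Q ^ ((N : ℤ) + 1 + n) * gaussCoeff Q N (n + 1) := by
  have e1 := eulerInv_sub_one h0 h1 (N + 1 + n)
  have e2 := eulerInv_sub_one h0 h1 (N + 1 + n - 1)
  have e3 := eulerInv_sub_one h0 h1 (N + 1 - n)
  have e4 := eulerInv_sub_one h0 h1 (N + 1 - n - 1)
  have hX : Q ^ ((N : ℤ) + 1 + n - 1) = Q ^ ((N : ℤ) + 1 + n) / Q := zpow_sub_one₀ h0.ne' _
  have hY : Q ^ ((N : ℤ) + 1 - n - 1) = Q ^ ((N : ℤ) + 1 - n) / Q := zpow_sub_one₀ h0.ne' _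
  have hXY : Q ^ ((N : ℤ) + 1 + n) * Q ^ ((N : ℤ) + 1 - n) = Q ^ (2 * N + 2) := by
    rw [← zpow_add₀ h0.ne', ← zpow_natCast]
    congr 1
    push_cast
    ring
  have hQ : Q ^ (2 * N + 2) = Q * Q ^ (2 * N + 1) := by ring
  rw [hX, e1] at e2
  rw [hY, e3] at e4
  simp only [gaussCoeff, Nat.cast_add, Nat.cast_one]
  rw [show (N : ℤ) + n = N + 1 + n - 1 by ring, show (N : ℤ) - n = N + 1 - n - 1 by ring,
    show (N : ℤ) + (n - 1) = N + 1 + n - 1 - 1 by ring,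
    show (N : ℤ) - (n + 1) = N + 1 - n - 1 - 1 by ring,
    show (N : ℤ) - (n - 1) = N + 1 - n by ring,
    show (N : ℤ) + (n + 1) = N + 1 + n by ring, e1, e2, e3, e4,
    show eulerProd Q (2 * (N + 1)) =
      eulerProd Q (2 * N) * (1 - Q ^ (2 * N + 1)) * (1 - Q ^ (2 * N + 2)) by
      simp only [eulerProd, mul_add, mul_one, Finset.prod_range_succ]]
  set X := Q ^ ((N : ℤ) + 1 + n)
  set Y := Q ^ ((N : ℤ) + 1 - n)
  set R := Q ^ (2 * N + 1)
  have hR : R = X * Y / Q := by rw [eq_div_iff h0.ne', hXY, hQ]; ring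
  have hQ0 := h0.ne'
  rw [← hXY, hR]
  field_simp
  ring

lemma abs_gaussCoeff_le (h0 : 0 < Q) (h1 : Q < 1) (N : ℕ) (n : ℤ) :
    |gaussCoeff Q N n| ≤ (eulerLimit Q)⁻¹ * (eulerLimit Q)⁻¹ := by
  have h3 : eulerProd Q (2 * N) ≤ 1 := by
    simpa [eulerProd] using antitone_eulerProd h0 h1 (Nat.zero_le (2 * N))
  have hi := fun m ↦ eulerInv_nonneg h0 h1 m
  have hp := (eulerProd_pos h0 h1 (2 * N)).le
  rw [gaussCoeff, abs_of_nonneg (mul_nonneg (mul_nonneg hp (hi _)) (hi _))]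
  refine mul_le_mul ?_ (eulerInv_le h0 h1 _) (hi _) (inv_pos.2 (eulerLimit_pos h0 h1)).le
  exact (mul_le_of_le_one_left (hi _) h3).trans (eulerInv_le h0 h1 _)

lemma tendsto_eulerInv (h0 : 0 < Q) (h1 : Q < 1) :
    Tendsto (eulerInv Q) atTop (𝓝 (eulerLimit Q)⁻¹) := by
  have ht : Tendsto Int.toNat atTop atTop :=
    tendsto_atTop.2 fun b ↦ (eventually_ge_atTop (b : ℤ)).mono fun m hm ↦ by omega
  refine (((tendsto_eulerProd h0 h1).comp ht).inv₀ (eulerLimit_pos h0 h1).ne').congr' ?_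
  filter_upwards [eventually_ge_atTop (0 : ℤ)] with m hm
  simp [eulerInv, hm]

lemma tendsto_gaussCoeff (h0 : 0 < Q) (h1 : Q < 1) (n : ℤ) :
    Tendsto (fun N ↦ gaussCoeff Q N n) atTop (𝓝 (eulerLimit Q)⁻¹) := by
  have hp := (tendsto_eulerProd h0 h1).comp (tendsto_id.const_mul_atTop' (two_pos : 0 < 2))
  have ha := (tendsto_eulerInv h0 h1).comp
    (tendsto_atTop_add_const_right _ n (tendsto_natCast_atTop_atTop (R := ℤ)))
  have hb := (tendsto_eulerInv h0 h1).comp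
    (tendsto_atTop_add_const_right _ (-n) (tendsto_natCast_atTop_atTop (R := ℤ)))
  have h := (hp.mul ha).mul hb
  rw [mul_inv_cancel₀ (eulerLimit_pos h0 h1).ne', one_mul] at h
  exact h

end

/-- The finite form of the triple product identity, a case of the `q`-binomial theorem. -/
lemma hasSum_finite_triple_product {p : ℝ} (h0 : 0 < p) (h1 : p < 1) {w : ℂ} (hw : w ≠ 0)
    (N : ℕ) :
    HasSum (fun n : ℤ ↦ (p : ℂ) ^ (n ^ 2) * w ^ n * (gaussCoeff (p ^ 2) N n : ℂ))
      (∏ j ∈ Finset.range N,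
        (1 + (p : ℂ) ^ (2 * j + 1) * w) * (1 + (p : ℂ) ^ (2 * j + 1) / w)) := by
  have hQ0 : 0 < p ^ 2 := by positivity
  have hQ1 : p ^ 2 < 1 := pow_lt_one₀ h0.le h1 two_ne_zero
  have hp : (p : ℂ) ≠ 0 := by exact_mod_cast h0.ne'
  induction N with
  | zero =>
    convert hasSum_single (0 : ℤ) ?_ using 1
    · simp [gaussCoeff, eulerInv, eulerProd]
    · intro n hn
      have : gaussCoeff (p ^ 2) 0 n = 0 := by
        rcases lt_or_gt_of_ne hn with h | h
        · simp [gaussCoeff, eulerInv, h]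
        · simp [gaussCoeff, eulerInv, h]
      simp [this]
  | succ N ih =>
    have hm := (Equiv.subRight (1 : ℤ)).hasSum_iff.2 ih
    have hpl := (Equiv.addRight (1 : ℤ)).hasSum_iff.2 ih
    have h := ((ih.mul_left (1 + (p : ℂ) ^ (4 * N + 2))).add
      (hm.mul_left ((p : ℂ) ^ (2 * N + 1) * w))).add (hpl.mul_left ((p : ℂ) ^ (2 * N + 1) / w))
    refine (congrArg₂ (HasSum · ·) (funext fun n ↦ ?_) ?_).mpr h
    · simp only [Function.comp, Equiv.subRight_apply, Equiv.coe_addRight]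
      rw [gaussCoeff_succ hQ0 hQ1]
      push_cast
      have a1 : (p : ℂ) ^ ((n - 1) ^ 2) = (p : ℂ) ^ (n ^ 2) * (p : ℂ) ^ (-(2 * n)) * p := by
        rw [← zpow_add₀ hp, ← zpow_add_one₀ hp]; ring_nf
      have a2 : (p : ℂ) ^ ((n + 1) ^ 2) = (p : ℂ) ^ (n ^ 2) * (p : ℂ) ^ (2 * n) * p := by
        rw [← zpow_add₀ hp, ← zpow_add_one₀ hp]; ring_nf
      have b1 : ((p : ℂ) ^ 2) ^ ((N : ℤ) + 1 - n) =
          (p : ℂ) ^ (2 * N + 1) * (p : ℂ) ^ (-(2 * n)) * p := by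
        rw [← zpow_natCast, ← zpow_natCast, ← zpow_mul, ← zpow_add₀ hp, ← zpow_add_one₀ hp]
        push_cast; ring_nf
      have b2 : ((p : ℂ) ^ 2) ^ ((N : ℤ) + 1 + n) =
          (p : ℂ) ^ (2 * N + 1) * (p : ℂ) ^ (2 * n) * p := by
        rw [← zpow_natCast, ← zpow_natCast, ← zpow_mul, ← zpow_add₀ hp, ← zpow_add_one₀ hp]
        push_cast; ring_nf
      rw [a1, a2, b1, b2, zpow_sub_one₀ hw, zpow_add_one₀ hw]
      field_simp
      ring_nf
    · rw [Finset.prod_range_succ]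
      field_simp
      ring_nf

lemma qPochInf_eq (z q : ℂ) : qPochInf z q = ∏' n : ℕ, (1 + -(z * q ^ n)) := by
  simp only [qPochInf, sub_eq_add_neg]

lemma summable_neg_mul_pow (z : ℂ) {q : ℂ} (hq : ‖q‖ < 1) :
    Summable fun n : ℕ ↦ -(z * q ^ n) :=
  ((summable_geometric_of_norm_lt_one hq).mul_left z).neg

lemma hasProd_qPochInf (z : ℂ) {q : ℂ} (hq : ‖q‖ < 1) :
    HasProd (fun n : ℕ ↦ 1 - z * q ^ n) (qPochInf z q) := by
  rw [qPochInf_eq]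
  simpa only [← sub_eq_add_neg] using
    (Complex.multipliable_one_add_of_summable (summable_neg_mul_pow z hq)).hasProd

lemma qPochInf_ne_zero {z q : ℂ} (hz : ‖z‖ < 1) (hq : ‖q‖ < 1) : qPochInf z q ≠ 0 := by
  rw [qPochInf_eq]
  refine tprod_one_add_ne_zero_of_summable (fun n h ↦ ?_) (summable_neg_mul_pow z hq).norm
  have h1 : z * q ^ n = 1 := by linear_combination -h
  have h2 : ‖z * q ^ n‖ < 1 := by
    rw [norm_mul, norm_pow]
    exact mul_lt_one_of_nonneg_of_lt_one_left (norm_nonneg _) hz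
      (pow_le_one₀ (norm_nonneg _) hq.le)
  rw [h1, norm_one] at h2
  exact lt_irrefl _ h2

lemma qPochInf_step (z : ℂ) {q : ℂ} (hq : ‖q‖ < 1) :
    qPochInf z q = (1 - z) * qPochInf (z * q) q := by
  have h := hasProd_qPochInf (z * q) hq
  simp only [mul_assoc z q, ← pow_succ'] at h
  have h' := tprod_eq_zero_mul' (f := fun n : ℕ ↦ 1 - z * q ^ n) h.multipliable
  simp only [h.tprod_eq, pow_zero, mul_one] at h'
  exact h'

lemma qPochInf_conj (z : ℂ) {q : ℝ} (hq0 : 0 < q) (hq : q < 1) :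
    qPochInf ((starRingEnd ℂ) z) q = (starRingEnd ℂ) (qPochInf z q) := by
  have hq' : ‖(q : ℂ)‖ < 1 := by rwa [norm_real, Real.norm_of_nonneg hq0.le]
  have h : HasProd (fun n : ℕ ↦ (starRingEnd ℂ) (1 - z * (q : ℂ) ^ n))
      ((starRingEnd ℂ) (qPochInf z q)) :=
    (hasProd_qPochInf z hq').map (starRingEnd ℂ) continuous_conj
  refine (hasProd_qPochInf _ hq').unique ((congrArg (HasProd · _) (funext fun n ↦ ?_)).mpr h)
  simp only [map_sub, map_one, map_mul, map_pow, conj_ofReal]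

lemma qPochInf_mul_conj (z : ℂ) {q : ℝ} (hq0 : 0 < q) (hq : q < 1) :
    qPochInf z q * qPochInf ((starRingEnd ℂ) z) q = (‖qPochInf z q‖ ^ 2 : ℝ) := by
  rw [qPochInf_conj z hq0 hq, Complex.mul_conj, Complex.normSq_eq_norm_sq]

/-- Jacobi's triple product identity at `τ = is`, with `p = e^{-πs}` and `w = e^{2πiz}`. -/
lemma jacobiTheta₂_eq_qPochInf (z : ℂ) {s : ℝ} (hs : 0 < s) {p : ℝ}
    (hp : p = Real.exp (-(π * s))) :
    jacobiTheta₂ z (I * s) = eulerLimit (p ^ 2) *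
      (qPochInf (-(p * cexp (2 * π * I * z))) (p ^ 2 : ℝ) *
        qPochInf (-(p * cexp (-(2 * π * I * z)))) (p ^ 2 : ℝ)) := by
  have h0 : 0 < p := hp ▸ Real.exp_pos _
  have h1 : p < 1 := by rw [hp, Real.exp_lt_one_iff]; nlinarith [mul_pos Real.pi_pos hs]
  have hQ0 : 0 < p ^ 2 := by positivity
  have hQ1 : p ^ 2 < 1 := pow_lt_one₀ h0.le h1 two_ne_zero
  have hQ : ‖((p ^ 2 : ℝ) : ℂ)‖ < 1 := by rwa [norm_real, Real.norm_of_nonneg hQ0.le]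
  set w := cexp (2 * π * I * z) with hw
  have hw0 : w ≠ 0 := Complex.exp_ne_zero _
  have hterm (n : ℤ) : jacobiTheta₂_term n z (I * s) = (p : ℂ) ^ (n ^ 2) * w ^ n := by
    rw [jacobiTheta₂_term, hp, hw, ofReal_exp, ← exp_int_mul, ← exp_int_mul, ← Complex.exp_add]
    push_cast
    congr 1
    linear_combination (π * s * n ^ 2 : ℂ) * I_sq
  have hsum : Summable fun n : ℤ ↦ (p : ℂ) ^ (n ^ 2) * w ^ n := by
    simp only [← hterm]
    exact (summable_jacobiTheta₂_term_iff z _).2 (by simpa using hs)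
  have hl := ((hasProd_qPochInf (-(p * w)) hQ).mul
    (hasProd_qPochInf (-(p * w⁻¹)) hQ)).tendsto_prod_nat
  -- let `N → ∞` in the finite identity, by dominated convergence
  have hr : Tendsto (fun N ↦ ∑' n : ℤ, (p : ℂ) ^ (n ^ 2) * w ^ n * (gaussCoeff (p ^ 2) N n : ℂ))
      atTop (𝓝 (∑' n : ℤ, (p : ℂ) ^ (n ^ 2) * w ^ n * ((eulerLimit (p ^ 2))⁻¹ : ℝ))) := by
    refine tendsto_tsum_of_dominated_convergence
      (bound := fun n : ℤ ↦ ‖(p : ℂ) ^ (n ^ 2) * w ^ n‖ *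
        ((eulerLimit (p ^ 2))⁻¹ * (eulerLimit (p ^ 2))⁻¹)) (hsum.norm.mul_right _)
      (fun n ↦ ((continuous_ofReal.tendsto _).comp (tendsto_gaussCoeff hQ0 hQ1 n)).const_mul _)
      (Eventually.of_forall fun N n ↦ ?_)
    rw [norm_mul, norm_real, Real.norm_eq_abs]
    exact mul_le_mul_of_nonneg_left (abs_gaussCoeff_le hQ0 hQ1 N n) (norm_nonneg _)
  simp only [(hasSum_finite_triple_product h0 h1 hw0 _).tsum_eq] at hr
  have hlr := tendsto_nhds_unique hr (hl.congr fun N ↦ Finset.prod_congr rfl fun j _ ↦ by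
    push_cast; ring_nf)
  rw [tsum_mul_right] at hlr
  have hE : ((eulerLimit (p ^ 2) : ℝ) : ℂ) ≠ 0 := by exact_mod_cast (eulerLimit_pos hQ0 hQ1).ne'
  rw [Complex.exp_neg, ← hw, ← hlr, jacobiTheta₂]
  simp only [hterm]
  push_cast
  field_simp

/-! ### Theta functions on the real line, at purely imaginary `τ` -/

lemma I_mul_ofReal_im_pos {t : ℝ} (ht : 0 < t) : 0 < (I * (t : ℂ)).im := by simpa using ht

lemma conj_exp_mul_I (y : ℝ) : (starRingEnd ℂ) (cexp (y * I)) = cexp (-(y * I)) := by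
  rw [← exp_conj, map_mul, conj_I, conj_ofReal, mul_neg]

/-- On the real line `θ₃` is, up to a positive constant, the squared modulus of a `q`-product. -/
lemma theta3_ofReal {t : ℝ} (ht : 0 < t) (x : ℝ) {p : ℝ} (hp : p = Real.exp (-(π * t))) :
    theta3 x (I * t) = (eulerLimit (p ^ 2) *
      ‖qPochInf (-(p * cexp ((2 * π * x : ℝ) * I))) (p ^ 2 : ℝ)‖ ^ 2 : ℝ) := by
  have h0 : 0 < p := hp ▸ Real.exp_pos _
  have h1 : p < 1 := by rw [hp, Real.exp_lt_one_iff]; nlinarith [mul_pos Real.pi_pos ht]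
  rw [theta3, jacobiTheta₂_eq_qPochInf _ ht hp, ofReal_mul,
    ← qPochInf_mul_conj _ (by positivity) (pow_lt_one₀ h0.le h1 two_ne_zero), map_neg, map_mul,
    conj_ofReal, conj_exp_mul_I, show 2 * π * I * (x : ℂ) = (2 * π * x : ℝ) * I by push_cast; ring]

/-- On the real line `θ₂` is, up to a positive constant, `cos πx` times the squared modulus of a
`q`-product. -/
lemma theta2_ofReal {t : ℝ} (ht : 0 < t) (x : ℝ) {p : ℝ} (hp : p = Real.exp (-(π * t))) :
    theta2 x (I * t) = (2 * Real.exp (-(π * t) / 4) * Real.cos (π * x) * (eulerLimit (p ^ 2) *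
      ‖qPochInf (-(p ^ 2 * cexp ((2 * π * x : ℝ) * I))) (p ^ 2 : ℝ)‖ ^ 2) : ℝ) := by
  have h0 : 0 < p := hp ▸ Real.exp_pos _
  have h1 : p < 1 := by rw [hp, Real.exp_lt_one_iff]; nlinarith [mul_pos Real.pi_pos ht]
  have hQ0 : 0 < p ^ 2 := by positivity
  have hQ1 : p ^ 2 < 1 := pow_lt_one₀ h0.le h1 two_ne_zero
  have hQ : ‖((p ^ 2 : ℝ) : ℂ)‖ < 1 := by rwa [norm_real, Real.norm_of_nonneg hQ0.le]
  have hpc : (p : ℂ) = cexp (-(π * t)) := by rw [hp, ofReal_exp]; push_cast; rfl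
  obtain ⟨α, hα⟩ : ∃ α : ℂ, α = ((2 * π * x : ℝ) : ℂ) * I := ⟨_, rfl⟩
  have e1 : (p : ℂ) * cexp (2 * π * I * (x + I * t / 2)) = p ^ 2 * cexp α := by
    rw [hpc, ← Complex.exp_nat_mul, ← Complex.exp_add, ← Complex.exp_add, hα]
    congr 1
    push_cast
    linear_combination (π * t : ℂ) * I_sq
  have e2 : (p : ℂ) * cexp (-(2 * π * I * (x + I * t / 2))) = cexp (-α) := by
    rw [hpc, ← Complex.exp_add, hα]
    congr 1
    push_cast
    linear_combination -(π * t : ℂ) * I_sq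
  have e3 : cexp (π * I * (I * t) / 4 + π * I * x) * (1 + cexp (-α)) =
      2 * cexp (-(π * t) / 4) * Complex.cos (π * x) := by
    rw [mul_comm 2 (cexp _), mul_assoc (cexp _) 2, two_cos, mul_add, mul_add,
      ← Complex.exp_add, ← Complex.exp_add, mul_one, ← Complex.exp_add, hα]
    congr 2
    · linear_combination (π * t / 4 : ℂ) * I_sq
    · push_cast
      linear_combination (π * t / 4 : ℂ) * I_sq
  have e4 := qPochInf_mul_conj (-(p ^ 2 * cexp α)) hQ0 hQ1
  rw [map_neg, map_mul, map_pow, conj_ofReal, hα, conj_exp_mul_I, ← hα] at e4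
  rw [theta2, jacobiTheta₂_eq_qPochInf _ ht hp, e1, e2, qPochInf_step (-cexp (-α)) hQ, ← hα,
    ofReal_mul _ (eulerLimit _ * _), ofReal_mul (eulerLimit _), ← e4, sub_neg_eq_add,
    show -cexp (-α) * ((p ^ 2 : ℝ) : ℂ) = -(p ^ 2 * cexp (-α)) by push_cast; ring]
  push_cast at e3 ⊢
  rw [← e3]
  ring

/-- `θ₃(x | it)` for real `x`, as a real number. -/
def realTheta3 (t x : ℝ) : ℝ := (theta3 x (I * t)).re

/-- `θ₄(x | it)` for real `x`, as a real number. -/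
def realTheta4 (t x : ℝ) : ℝ := (theta4 x (I * t)).re

/-- `θ₂(x | it)` for real `x`, as a real number. -/
def realTheta2 (t x : ℝ) : ℝ := (theta2 x (I * t)).re

/-- `θ₁(x | it)` for real `x`, as a real number. -/
def realTheta1 (t x : ℝ) : ℝ := (theta1 x (I * t)).re

lemma ofReal_realTheta3 {t : ℝ} (ht : 0 < t) (x : ℝ) :
    (realTheta3 t x : ℂ) = theta3 x (I * t) := by
  rw [realTheta3, theta3_ofReal ht x rfl, ofReal_re]

lemma ofReal_realTheta2 {t : ℝ} (ht : 0 < t) (x : ℝ) :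
    (realTheta2 t x : ℂ) = theta2 x (I * t) := by
  rw [realTheta2, theta2_ofReal ht x rfl, ofReal_re]

lemma realTheta4_eq (t x : ℝ) : realTheta4 t x = realTheta3 t (x + 1 / 2) := by
  rw [realTheta4, realTheta3, ← theta3_add_half]; push_cast; rfl

lemma realTheta1_eq (t x : ℝ) : realTheta1 t x = -realTheta2 t (x + 1 / 2) := by
  rw [realTheta1, realTheta2, theta1, neg_re]; push_cast; rfl

lemma ofReal_realTheta4 {t : ℝ} (ht : 0 < t) (x : ℝ) :
    (realTheta4 t x : ℂ) = theta4 x (I * t) := by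
  rw [realTheta4_eq, ofReal_realTheta3 ht, ← theta3_add_half]; push_cast; rfl

lemma ofReal_realTheta1 {t : ℝ} (ht : 0 < t) (x : ℝ) :
    (realTheta1 t x : ℂ) = theta1 x (I * t) := by
  rw [realTheta1_eq, ofReal_neg, ofReal_realTheta2 ht, theta1]; push_cast; rfl

lemma exp_neg_pi_mul_pos_lt_one {t : ℝ} (ht : 0 < t) :
    0 < Real.exp (-(π * t)) ∧ Real.exp (-(π * t)) < 1 :=
  ⟨Real.exp_pos _, by rw [Real.exp_lt_one_iff]; nlinarith [mul_pos Real.pi_pos ht]⟩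

lemma norm_neg_mul_exp_mul_I {y : ℝ} (hy : 0 ≤ y) (α : ℝ) : ‖-((y : ℂ) * cexp (α * I))‖ = y := by
  rw [norm_neg, norm_mul, norm_exp_ofReal_mul_I, mul_one, norm_real, Real.norm_of_nonneg hy]

lemma realTheta3_pos {t : ℝ} (ht : 0 < t) (x : ℝ) : 0 < realTheta3 t x := by
  obtain ⟨h0, h1⟩ := exp_neg_pi_mul_pos_lt_one ht
  have hQ0 : 0 < Real.exp (-(π * t)) ^ 2 := by positivity
  have hQ1 : Real.exp (-(π * t)) ^ 2 < 1 := pow_lt_one₀ h0.le h1 two_ne_zero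
  rw [realTheta3, theta3_ofReal ht x rfl, ofReal_re]
  refine mul_pos (eulerLimit_pos hQ0 hQ1) (pow_pos (norm_pos_iff.2 (qPochInf_ne_zero ?_ ?_)) 2)
  · rwa [norm_neg_mul_exp_mul_I h0.le]
  · rwa [norm_real, Real.norm_of_nonneg hQ0.le]

lemma realTheta4_pos {t : ℝ} (ht : 0 < t) (x : ℝ) : 0 < realTheta4 t x := by
  rw [realTheta4_eq]; exact realTheta3_pos ht _

lemma realTheta2_pos {t : ℝ} (ht : 0 < t) {x : ℝ} (hx : x ∈ Set.Ico 0 (1 / 2)) :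
    0 < realTheta2 t x := by
  obtain ⟨h0, h1⟩ := exp_neg_pi_mul_pos_lt_one ht
  have hQ0 : 0 < Real.exp (-(π * t)) ^ 2 := by positivity
  have hQ1 : Real.exp (-(π * t)) ^ 2 < 1 := pow_lt_one₀ h0.le h1 two_ne_zero
  have hcos : 0 < Real.cos (π * x) := by
    apply Real.cos_pos_of_mem_Ioo
    constructor <;> nlinarith [Real.pi_pos, hx.1, hx.2]
  rw [realTheta2, theta2_ofReal ht x rfl, ofReal_re]
  refine mul_pos (mul_pos (by positivity) hcos) (mul_pos (eulerLimit_pos hQ0 hQ1)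
    (pow_pos (norm_pos_iff.2 (qPochInf_ne_zero ?_ ?_)) 2))
  · rwa [← ofReal_pow, norm_neg_mul_exp_mul_I hQ0.le]
  · rwa [norm_real, Real.norm_of_nonneg hQ0.le]

/-- A complex-differentiable function which is real on the real line has a real derivative there. -/
lemma hasDerivAt_of_ofReal_eq {F : ℂ → ℂ} {f : ℝ → ℝ} (hF : Differentiable ℂ F)
    (h : ∀ x : ℝ, (f x : ℂ) = F x) (x : ℝ) :
    HasDerivAt f (deriv f x) x ∧ deriv F x = (deriv f x : ℝ) := by
  have h1 := (hF x).hasDerivAt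
  have h2 : HasDerivAt f (deriv F x).re x := by
    convert h1.real_of_complex using 1
    funext y
    rw [← h, ofReal_re]
  have h3 := h1.comp_ofReal
  simp only [← h] at h3
  exact ⟨h2.differentiableAt.hasDerivAt, h2.deriv ▸ h3.unique h2.ofReal_comp⟩

lemma realTheta1_add_half (t x : ℝ) : realTheta1 t (x + 1 / 2) = realTheta2 t x := by
  rw [realTheta1, realTheta2, ← theta1_add_half]; push_cast; rfl

lemma realTheta2_add_half (t x : ℝ) : realTheta2 t (x + 1 / 2) = -realTheta1 t x := by
  rw [realTheta1_eq, neg_neg]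

lemma realTheta1_zero (t : ℝ) : realTheta1 t 0 = 0 := by simp [realTheta1]

lemma realTheta_relations {t : ℝ} (ht : 0 < t) (x : ℝ) :
    realTheta4 t 0 ^ 2 * realTheta3 t x ^ 2 =
        realTheta3 t 0 ^ 2 * realTheta4 t x ^ 2 - realTheta2 t 0 ^ 2 * realTheta1 t x ^ 2 ∧
      realTheta3 t 0 ^ 4 = realTheta2 t 0 ^ 4 + realTheta4 t 0 ^ 4 := by
  have hτ := I_mul_ofReal_im_pos ht
  have h1 := theta3_theta4_theta1_sq x hτ
  have h2 := theta_const_quartic hτ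
  simp only [← ofReal_zero, ← ofReal_realTheta1 ht, ← ofReal_realTheta2 ht,
    ← ofReal_realTheta3 ht, ← ofReal_realTheta4 ht] at h1 h2
  exact ⟨by exact_mod_cast h1, by exact_mod_cast h2⟩

lemma realTheta_wronskians {t : ℝ} (ht : 0 < t) (x : ℝ) :
    ∃ d1 d2 d4, HasDerivAt (realTheta1 t) d1 x ∧ HasDerivAt (realTheta2 t) d2 x ∧
      HasDerivAt (realTheta4 t) d4 x ∧
      realTheta2 t 0 * realTheta3 t 0 * (d1 * realTheta4 t x - realTheta1 t x * d4) =
        deriv (realTheta1 t) 0 * realTheta4 t 0 * (realTheta2 t x * realTheta3 t x) ∧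
      realTheta2 t 0 * realTheta4 t 0 * (d2 * realTheta4 t x - realTheta2 t x * d4) =
        -(deriv (realTheta1 t) 0 * realTheta3 t 0 * (realTheta1 t x * realTheta3 t x)) := by
  have hτ := I_mul_ofReal_im_pos ht
  obtain ⟨h1, e1⟩ := hasDerivAt_of_ofReal_eq (differentiable_theta1 hτ) (ofReal_realTheta1 ht) x
  obtain ⟨h2, e2⟩ := hasDerivAt_of_ofReal_eq (differentiable_theta2 hτ) (ofReal_realTheta2 ht) x
  obtain ⟨h4, e4⟩ := hasDerivAt_of_ofReal_eq (differentiable_theta4 hτ) (ofReal_realTheta4 ht) x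
  have e0 := (hasDerivAt_of_ofReal_eq (differentiable_theta1 hτ) (ofReal_realTheta1 ht) 0).2
  have w1 := wronskian_theta1_theta4 x hτ
  have w2 := wronskian_theta2_theta4 x hτ
  rw [← ofReal_zero, e0] at w1 w2
  rw [e1, e4] at w1
  rw [e2, e4] at w2
  simp only [← ofReal_realTheta1 ht, ← ofReal_realTheta2 ht,
    ← ofReal_realTheta3 ht, ← ofReal_realTheta4 ht] at w1 w2
  exact ⟨_, _, _, h1, h2, h4, by exact_mod_cast w1, by exact_mod_cast w2⟩

end

/-! ### Jacobi elliptic functions as theta quotients -/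

/-- The modulus `k = θ₂²/θ₃²` attached to `τ = it`. -/
def thetaModulus (t : ℝ) : ℝ := (realTheta2 t 0 / realTheta3 t 0) ^ 2

/-- The real period `2K` attached to `τ = it`, as the constant `θ₁'θ₃/(θ₂θ₄)`
built from values and derivative at `0`. -/
def thetaPeriod (t : ℝ) : ℝ :=
  deriv (realTheta1 t) 0 * realTheta3 t 0 / (realTheta2 t 0 * realTheta4 t 0)

/-- The theta quotient which is `sn(2Kx)`. -/
def thetaSn (t x : ℝ) : ℝ :=
  realTheta3 t 0 * realTheta1 t x / (realTheta2 t 0 * realTheta4 t x)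

/-- The theta quotient which is `cn(2Kx)`. -/
def thetaCn (t x : ℝ) : ℝ :=
  realTheta4 t 0 * realTheta2 t x / (realTheta2 t 0 * realTheta4 t x)

/-- The theta quotient which is `dn(2Kx)`. -/
def thetaDn (t x : ℝ) : ℝ :=
  realTheta4 t 0 * realTheta3 t x / (realTheta3 t 0 * realTheta4 t x)

lemma realTheta2_zero_pos {t : ℝ} (ht : 0 < t) : 0 < realTheta2 t 0 :=
  realTheta2_pos ht (by norm_num)

lemma thetaModulus_pos {t : ℝ} (ht : 0 < t) : 0 < thetaModulus t :=
  pow_pos (div_pos (realTheta2_zero_pos ht) (realTheta3_pos ht 0)) 2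

lemma one_sub_thetaModulus_sq {t : ℝ} (ht : 0 < t) :
    1 - thetaModulus t ^ 2 = ((realTheta4 t 0 / realTheta3 t 0) ^ 2) ^ 2 := by
  have h := (realTheta_relations ht 0).2
  have h3 := (realTheta3_pos ht 0).ne'
  rw [thetaModulus]
  field_simp
  linear_combination h

lemma thetaModulus_lt_one {t : ℝ} (ht : 0 < t) : thetaModulus t < 1 := by
  have h := one_sub_thetaModulus_sq ht
  have h1 : 0 < ((realTheta4 t 0 / realTheta3 t 0) ^ 2) ^ 2 := by
    have := realTheta4_pos ht 0
    have := realTheta3_pos ht 0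
    positivity
  nlinarith [thetaModulus_pos ht]

section

variable {t : ℝ} (ht : 0 < t) (x : ℝ)
include ht

lemma thetaDn_pos : 0 < thetaDn t x :=
  div_pos (mul_pos (realTheta4_pos ht 0) (realTheta3_pos ht x))
    (mul_pos (realTheta3_pos ht 0) (realTheta4_pos ht x))

lemma thetaDn_sq : thetaDn t x ^ 2 = 1 - thetaModulus t ^ 2 * thetaSn t x ^ 2 := by
  have h := (realTheta_relations ht x).1
  have h2 := (realTheta2_zero_pos ht).ne'
  have h3 := (realTheta3_pos ht 0).ne'
  have h4 := (realTheta4_pos ht x).ne'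
  rw [thetaDn, thetaModulus, thetaSn]
  field_simp
  linear_combination h

lemma hasDerivAt_thetaSn :
    HasDerivAt (thetaSn t) (thetaPeriod t * thetaCn t x * thetaDn t x) x := by
  obtain ⟨d1, d2, d4, h1, h2, h4, w1, w2⟩ := realTheta_wronskians ht x
  have b0 := (realTheta2_zero_pos ht).ne'
  have a0 := (realTheta3_pos ht 0).ne'
  have c0 := (realTheta4_pos ht 0).ne'
  have n4 := (realTheta4_pos ht x).ne'
  have h := (h1.const_mul (realTheta3 t 0)).div (h4.const_mul (realTheta2 t 0))
    (mul_ne_zero b0 n4)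
  refine h.congr_deriv ?_
  rw [thetaPeriod, thetaCn, thetaDn]
  field_simp
  linear_combination w1

lemma hasDerivAt_thetaCn :
    HasDerivAt (thetaCn t) (-(thetaPeriod t * thetaSn t x * thetaDn t x)) x := by
  obtain ⟨d1, d2, d4, h1, h2, h4, w1, w2⟩ := realTheta_wronskians ht x
  have b0 := (realTheta2_zero_pos ht).ne'
  have a0 := (realTheta3_pos ht 0).ne'
  have c0 := (realTheta4_pos ht 0).ne'
  have n4 := (realTheta4_pos ht x).ne'
  have h := (h2.const_mul (realTheta4 t 0)).div (h4.const_mul (realTheta2 t 0))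
    (mul_ne_zero b0 n4)
  refine h.congr_deriv ?_
  rw [thetaPeriod, thetaSn, thetaDn]
  field_simp
  linear_combination w2

lemma thetaDn_eq_sqrt : thetaDn t x = √(1 - thetaModulus t ^ 2 * thetaSn t x ^ 2) := by
  rw [← thetaDn_sq ht x, Real.sqrt_sq (thetaDn_pos ht x).le]

end

lemma continuous_thetaDn {t : ℝ} (ht : 0 < t) : Continuous (thetaDn t) := by
  rw [show thetaDn t = fun x ↦ √(1 - thetaModulus t ^ 2 * thetaSn t x ^ 2) from
    funext (thetaDn_eq_sqrt ht)]
  have : Continuous (thetaSn t) :=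
    continuous_iff_continuousAt.2 fun x ↦ (hasDerivAt_thetaSn ht x).continuousAt
  fun_prop

lemma thetaSn_zero (t : ℝ) : thetaSn t 0 = 0 := by simp [thetaSn, realTheta1_zero]

lemma thetaCn_zero {t : ℝ} (ht : 0 < t) : thetaCn t 0 = 1 := by
  rw [thetaCn, mul_comm]
  exact div_self (mul_pos (realTheta2_zero_pos ht) (realTheta4_pos ht 0)).ne'

lemma thetaCn_half (t : ℝ) : thetaCn t (1 / 2) = 0 := by
  have h := realTheta2_add_half t 0
  rw [zero_add, realTheta1_zero, neg_zero] at h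
  rw [thetaCn, h, mul_zero, zero_div]

lemma thetaSn_half {t : ℝ} (ht : 0 < t) : thetaSn t (1 / 2) = 1 := by
  have h := realTheta1_add_half t 0
  have h4 : realTheta4 t (1 / 2) = realTheta3 t 0 := by
    rw [realTheta4, realTheta3, ← theta4_add_half]
    norm_num
  rw [zero_add] at h
  rw [thetaSn, h, h4, mul_comm]
  exact div_self (mul_pos (realTheta2_zero_pos ht) (realTheta3_pos ht 0)).ne'

/-- The amplitude `am(2Kx)`, as the primitive of `2K dn(2Kx)`. -/
def thetaAm (t x : ℝ) : ℝ := ∫ y in (0 : ℝ)..x, thetaPeriod t * thetaDn t y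

lemma hasDerivAt_thetaAm {t : ℝ} (ht : 0 < t) (x : ℝ) :
    HasDerivAt (thetaAm t) (thetaPeriod t * thetaDn t x) x :=
  ((continuous_thetaDn ht).const_mul _).integral_hasStrictDerivAt 0 x |>.hasDerivAt

lemma thetaAm_zero (t : ℝ) : thetaAm t 0 = 0 := intervalIntegral.integral_same

/-- The pair of theta quotients moves on the unit circle with angular velocity `2K dn(2Kx)`. -/
lemma thetaSn_thetaCn_eq {t : ℝ} (ht : 0 < t) (x : ℝ) :
    thetaSn t x = Real.sin (thetaAm t x) ∧ thetaCn t x = Real.cos (thetaAm t x) := by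
  have hS := hasDerivAt_thetaSn ht
  have hC := hasDerivAt_thetaCn ht
  have hA := hasDerivAt_thetaAm ht
  have h1 (y : ℝ) : HasDerivAt (fun y ↦ thetaCn t y * Real.cos (thetaAm t y) +
      thetaSn t y * Real.sin (thetaAm t y)) 0 y := by
    refine (((hC y).mul (hA y).cos).add ((hS y).mul (hA y).sin)).congr_deriv ?_
    ring
  have h2 (y : ℝ) : HasDerivAt (fun y ↦ thetaSn t y * Real.cos (thetaAm t y) -
      thetaCn t y * Real.sin (thetaAm t y)) 0 y := by
    refine (((hS y).mul (hA y).cos).sub ((hC y).mul (hA y).sin)).congr_deriv ?_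
    ring
  have e1 := is_const_of_deriv_eq_zero (fun y ↦ (h1 y).differentiableAt) (fun y ↦ (h1 y).deriv) x 0
  have e2 := is_const_of_deriv_eq_zero (fun y ↦ (h2 y).differentiableAt) (fun y ↦ (h2 y).deriv) x 0
  simp only [thetaAm_zero, thetaSn_zero, thetaCn_zero ht, Real.cos_zero, Real.sin_zero] at e1 e2
  have h3 := Real.sin_sq_add_cos_sq (thetaAm t x)
  constructor
  · linear_combination Real.sin (thetaAm t x) * e1 + Real.cos (thetaAm t x) * e2 -
      thetaSn t x * h3
  · linear_combination Real.cos (thetaAm t x) * e1 - Real.sin (thetaAm t x) * e2 -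
      thetaCn t x * h3

lemma thetaAm_half {t : ℝ} (ht : 0 < t) : thetaAm t (1 / 2) = π / 2 := by
  have hcont : Continuous (thetaAm t) :=
    continuous_iff_continuousAt.2 fun x ↦ (hasDerivAt_thetaAm ht x).continuousAt
  have hne (x : ℝ) (hx : x ∈ Set.Ico (0 : ℝ) (1 / 2)) : Real.cos (thetaAm t x) ≠ 0 := by
    rw [← (thetaSn_thetaCn_eq ht x).2, thetaCn]
    exact (div_pos (mul_pos (realTheta4_pos ht 0) (realTheta2_pos ht hx))
      (mul_pos (realTheta2_zero_pos ht) (realTheta4_pos ht x))).ne'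
  have hc : Real.cos (thetaAm t (1 / 2)) = 0 := by
    rw [← (thetaSn_thetaCn_eq ht _).2, thetaCn_half]
  have hs : Real.sin (thetaAm t (1 / 2)) = 1 := by
    rw [← (thetaSn_thetaCn_eq ht _).1, thetaSn_half ht]
  -- as `cn` has no zero before the quarter period, the amplitude cannot pass `±π/2` before it
  have hle : thetaAm t (1 / 2) ≤ π / 2 := by
    by_contra! h
    obtain ⟨y, hy, hyv⟩ := intermediate_value_Ico (by norm_num : (0 : ℝ) ≤ 1 / 2)
      hcont.continuousOn (show π / 2 ∈ Set.Ico (thetaAm t 0) (thetaAm t (1 / 2)) from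
        ⟨by rw [thetaAm_zero]; positivity, h⟩)
    exact hne y hy (by rw [hyv, Real.cos_pi_div_two])
  have hge : -(π / 2) ≤ thetaAm t (1 / 2) := by
    by_contra! h
    obtain ⟨y, hy, hyv⟩ := intermediate_value_Ico' (by norm_num : (0 : ℝ) ≤ 1 / 2)
      hcont.continuousOn (show -(π / 2) ∈ Set.Ioc (thetaAm t (1 / 2)) (thetaAm t 0) from
        ⟨h, by rw [thetaAm_zero]; linarith [Real.pi_pos]⟩)
    exact hne y hy (by rw [hyv, Real.cos_neg, Real.cos_pi_div_two])
  rw [← Real.arcsin_sin hge hle, hs, Real.arcsin_one]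

/-! ### The elliptic integral -/

lemma one_sub_sq_mul_sin_sq_pos {k : ℝ} (h0 : 0 < k) (h1 : k < 1) (φ : ℝ) :
    0 < 1 - k ^ 2 * Real.sin φ ^ 2 := by
  have := Real.sin_sq_le_one φ
  have : k ^ 2 < 1 := pow_lt_one₀ h0.le h1 two_ne_zero
  nlinarith [sq_nonneg (Real.sin φ), sq_nonneg k]

lemma continuous_ellipticF_integrand {k : ℝ} (h0 : 0 < k) (h1 : k < 1) :
    Continuous fun t : ℝ ↦ 1 / √(1 - k ^ 2 * Real.sin t ^ 2) :=
  continuous_const.div (by fun_prop)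
    fun t ↦ (Real.sqrt_pos.2 (one_sub_sq_mul_sin_sq_pos h0 h1 t)).ne'

lemma hasDerivAt_ellipticF {k : ℝ} (h0 : 0 < k) (h1 : k < 1) (φ : ℝ) :
    HasDerivAt (ellipticF k) (1 / √(1 - k ^ 2 * Real.sin φ ^ 2)) φ :=
  (continuous_ellipticF_integrand h0 h1).integral_hasStrictDerivAt 0 φ |>.hasDerivAt

lemma ellipticF_strictMono {k : ℝ} (h0 : 0 < k) (h1 : k < 1) : StrictMono (ellipticF k) := by
  refine strictMono_of_deriv_pos fun φ ↦ ?_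
  rw [(hasDerivAt_ellipticF h0 h1 φ).deriv]
  exact one_div_pos.2 (Real.sqrt_pos.2 (one_sub_sq_mul_sin_sq_pos h0 h1 φ))

lemma ellipticK_pos {k : ℝ} (h0 : 0 < k) (h1 : k < 1) : 0 < ellipticK k := by
  have h := ellipticF_strictMono h0 h1 (show (0 : ℝ) < π / 2 by positivity)
  rwa [show ellipticF k 0 = 0 from intervalIntegral.integral_same] at h

lemma ellipticK_lt {k l : ℝ} (h0 : 0 < k) (hkl : k < l) (h1 : l < 1) :
    ellipticK k < ellipticK l := by
  have hk1 := hkl.trans h1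
  have hl0 := h0.trans hkl
  have hsq : k ^ 2 < l ^ 2 := pow_lt_pow_left₀ hkl h0.le two_ne_zero
  refine intervalIntegral.integral_lt_integral_of_continuousOn_of_le_of_exists_lt
    (by positivity) (continuous_ellipticF_integrand h0 hk1).continuousOn
    (continuous_ellipticF_integrand hl0 h1).continuousOn (fun x _ ↦ ?_)
    ⟨π / 2, ⟨by positivity, le_rfl⟩, ?_⟩
  · refine one_div_le_one_div_of_le (Real.sqrt_pos.2 (one_sub_sq_mul_sin_sq_pos hl0 h1 x))
      (Real.sqrt_le_sqrt ?_)
    nlinarith [sq_nonneg (Real.sin x)]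
  · have hl := one_sub_sq_mul_sin_sq_pos hl0 h1 (π / 2)
    refine one_div_lt_one_div_of_lt (Real.sqrt_pos.2 hl) (Real.sqrt_lt_sqrt hl.le ?_)
    rw [Real.sin_pi_div_two]
    linarith

lemma ellipticF_thetaAm {t : ℝ} (ht : 0 < t) (x : ℝ) :
    ellipticF (thetaModulus t) (thetaAm t x) = thetaPeriod t * x := by
  have hF := hasDerivAt_ellipticF (thetaModulus_pos ht) (thetaModulus_lt_one ht)
  have h (y : ℝ) : HasDerivAt (fun y ↦ ellipticF (thetaModulus t) (thetaAm t y) -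
      thetaPeriod t * y) 0 y := by
    refine (((hF _).comp y (hasDerivAt_thetaAm ht y)).sub
      ((hasDerivAt_id y).const_mul (thetaPeriod t))).congr_deriv ?_
    rw [← (thetaSn_thetaCn_eq ht y).1, ← thetaDn_eq_sqrt ht]
    have := (thetaDn_pos ht y).ne'
    field_simp
    ring
  have e := is_const_of_deriv_eq_zero (fun y ↦ (h y).differentiableAt) (fun y ↦ (h y).deriv) x 0
  simp only [thetaAm_zero, show ellipticF (thetaModulus t) 0 = 0 from
    intervalIntegral.integral_same] at e
  linear_combination e

lemma ellipticK_thetaModulus {t : ℝ} (ht : 0 < t) :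
    ellipticK (thetaModulus t) = thetaPeriod t / 2 := by
  rw [ellipticK, ← thetaAm_half ht, ellipticF_thetaAm ht]
  ring

lemma thetaPeriod_pos {t : ℝ} (ht : 0 < t) : 0 < thetaPeriod t := by
  have h := ellipticK_pos (thetaModulus_pos ht) (thetaModulus_lt_one ht)
  rw [ellipticK_thetaModulus ht] at h
  linarith

lemma jacobiAm_thetaPeriod_mul {t : ℝ} (ht : 0 < t) (x : ℝ) :
    jacobiAm (thetaModulus t) (thetaPeriod t * x) = thetaAm t x := by
  rw [jacobiAm, ← ellipticF_thetaAm ht]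
  exact Function.leftInverse_invFun
    (ellipticF_strictMono (thetaModulus_pos ht) (thetaModulus_lt_one ht)).injective _

lemma jacobiSn_thetaPeriod_mul {t : ℝ} (ht : 0 < t) (x : ℝ) :
    jacobiSn (thetaModulus t) (thetaPeriod t * x) = thetaSn t x := by
  rw [jacobiSn, jacobiAm_thetaPeriod_mul ht, (thetaSn_thetaCn_eq ht x).1]

lemma jacobiCn_thetaPeriod_mul {t : ℝ} (ht : 0 < t) (x : ℝ) :
    jacobiCn (thetaModulus t) (thetaPeriod t * x) = thetaCn t x := by
  rw [jacobiCn, jacobiAm_thetaPeriod_mul ht, (thetaSn_thetaCn_eq ht x).2]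

lemma jacobiDn_thetaPeriod_mul {t : ℝ} (ht : 0 < t) (x : ℝ) :
    jacobiDn (thetaModulus t) (thetaPeriod t * x) = thetaDn t x := by
  rw [jacobiDn, jacobiSn_thetaPeriod_mul ht, ← thetaDn_eq_sqrt ht]

/-! ### The singular modulus -/

/-- Under `t ↦ 1/t` the modulus turns into the complementary modulus, and the real period is
multiplied by `t`. -/
lemma theta_modular_inv {t : ℝ} (ht : 0 < t) :
    thetaModulus (1 / t) = √(1 - thetaModulus t ^ 2) ∧
      thetaPeriod (1 / t) = t * thetaPeriod t := by
  have ht' : 0 < 1 / t := one_div_pos.2 ht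
  have htc : (t : ℂ) ≠ 0 := by exact_mod_cast ht.ne'
  have hτ := I_mul_ofReal_im_pos ht
  have hτ0 : Complex.I * (t : ℂ) ≠ 0 := mul_ne_zero Complex.I_ne_zero htc
  have hinv : -1 / (Complex.I * (t : ℂ)) = Complex.I * ((1 / t : ℝ) : ℂ) := by
    push_cast
    field_simp
    rw [Complex.I_sq]
  set c := thetaFactor 0 (Complex.I * t) with hc
  have hc0 : c ≠ 0 := thetaFactor_ne_zero 0 hτ0
  have m3 := theta3_modular 0 (Complex.I * t)
  have m2 := theta2_modular 0 hτ0
  have m4 := theta4_modular 0 hτ0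
  have m1 := deriv_theta1_zero_modular hτ
  have d1 := (hasDerivAt_of_ofReal_eq (differentiable_theta1 hτ) (ofReal_realTheta1 ht) 0).2
  have d1' := (hasDerivAt_of_ofReal_eq (differentiable_theta1 (I_mul_ofReal_im_pos ht'))
    (ofReal_realTheta1 ht') 0).2
  rw [Complex.ofReal_zero] at d1 d1'
  rw [zero_div, hinv, ← hc, ← Complex.ofReal_zero, ← ofReal_realTheta3 ht,
    ← ofReal_realTheta3 ht'] at m3
  rw [zero_div, hinv, ← hc, ← Complex.ofReal_zero, ← ofReal_realTheta2 ht,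
    ← ofReal_realTheta4 ht'] at m2
  rw [zero_div, hinv, ← hc, ← Complex.ofReal_zero, ← ofReal_realTheta4 ht,
    ← ofReal_realTheta2 ht'] at m4
  rw [hinv, ← hc, d1, d1', mul_div_mul_left _ _ Complex.I_ne_zero] at m1
  have n2 : (realTheta2 (1 / t) 0 : ℂ) ≠ 0 := by exact_mod_cast (realTheta2_zero_pos ht').ne'
  have n3 : (realTheta3 (1 / t) 0 : ℂ) ≠ 0 := by exact_mod_cast (realTheta3_pos ht' 0).ne'
  have n4 : (realTheta4 (1 / t) 0 : ℂ) ≠ 0 := by exact_mod_cast (realTheta4_pos ht' 0).ne'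
  constructor
  · rw [one_sub_thetaModulus_sq ht, Real.sqrt_sq (sq_nonneg _), thetaModulus]
    apply Complex.ofReal_injective
    push_cast at *
    rw [m4, m3]
    field_simp
  · apply Complex.ofReal_injective
    rw [thetaPeriod, thetaPeriod]
    push_cast at *
    rw [m4, m3, m2, m1]
    field_simp

lemma ellipticK_ratio_thetaModulus {t : ℝ} (ht : 0 < t) :
    ellipticK √(1 - thetaModulus t ^ 2) / ellipticK (thetaModulus t) = t := by
  obtain ⟨h1, h2⟩ := theta_modular_inv ht
  rw [← h1, ellipticK_thetaModulus (one_div_pos.2 ht), h2, ellipticK_thetaModulus ht]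
  have := (thetaPeriod_pos ht).ne'
  field_simp

lemma ellipticK_ratio_strictAnti {k l : ℝ} (h0 : 0 < k) (hkl : k < l) (h1 : l < 1) :
    ellipticK √(1 - l ^ 2) / ellipticK l < ellipticK √(1 - k ^ 2) / ellipticK k := by
  have hk1 := hkl.trans h1
  have hl0 := h0.trans hkl
  have hsq : k ^ 2 < l ^ 2 := pow_lt_pow_left₀ hkl h0.le two_ne_zero
  have hl2 : l ^ 2 < 1 := pow_lt_one₀ hl0.le h1 two_ne_zero
  have hk2 : 0 < k ^ 2 := by positivity
  have hlt : √(1 - l ^ 2) < √(1 - k ^ 2) := Real.sqrt_lt_sqrt (by linarith) (by linarith)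
  have hl' : 0 < √(1 - l ^ 2) := Real.sqrt_pos.2 (by linarith)
  have hk' : √(1 - k ^ 2) < 1 := (Real.sqrt_lt' one_pos).2 (by linarith)
  exact div_lt_div₀ (ellipticK_lt hl' hlt hk') (ellipticK_lt h0 hkl h1).le
    (ellipticK_pos (hl'.trans hlt) hk').le (ellipticK_pos h0 hk1)

lemma singularModulus_eq {r : ℝ} (hr : 0 < r) : singularModulus r = thetaModulus √r := by
  have ht := Real.sqrt_pos.2 hr
  have hm0 := thetaModulus_pos ht
  have hm1 := thetaModulus_lt_one ht
  have hm := ellipticK_ratio_thetaModulus ht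
  obtain ⟨h0, h1, h⟩ : 0 < singularModulus r ∧ singularModulus r < 1 ∧
      ellipticK √(1 - singularModulus r ^ 2) / ellipticK (singularModulus r) = √r :=
    Classical.epsilon_spec (p := fun k : ℝ =>
      0 < k ∧ k < 1 ∧ ellipticK √(1 - k ^ 2) / ellipticK k = √r) ⟨_, hm0, hm1, hm⟩
  rcases lt_trichotomy (singularModulus r) (thetaModulus √r) with hlt | heq | hlt
  · have := ellipticK_ratio_strictAnti h0 hlt hm1
    rw [h, hm] at this
    exact absurd this (lt_irrefl _)
  · exact heq
  · have := ellipticK_ratio_strictAnti hm0 hlt h1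
    rw [h, hm] at this
    exact absurd this (lt_irrefl _)

lemma periodK_eq {r : ℝ} (hr : 0 < r) : periodK r = thetaPeriod √r / 2 := by
  rw [periodK, singularModulus_eq hr, ellipticK_thetaModulus (Real.sqrt_pos.2 hr)]

section

open Complex

/-! ### The logarithm of a quotient of `q`-products -/

/-- The Lambert-type series `∑ 2 z^{2m+1} / ((2m+1)(1 - q^{2m+1}))`, which is a logarithm of
`(-z; q)_∞ / (z; q)_∞`. -/
def lambertLog (q : ℝ) (z : ℂ) : ℂ :=
  ∑' m : ℕ, 2 * z ^ (2 * m + 1) / ((2 * m + 1) * (1 - (q : ℂ) ^ (2 * m + 1)))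

lemma hasSum_log_one_add_sub_log_one_sub {w : ℂ} (hw : ‖w‖ < 1) :
    HasSum (fun m : ℕ ↦ 2 * w ^ (2 * m + 1) / (2 * m + 1)) (log (1 + w) - log (1 - w)) := by
  have h1 := hasSum_taylorSeries_neg_log' hw
  have h2 := hasSum_taylorSeries_neg_log' (z := -w) (by rwa [norm_neg])
  have h := h1.sub h2
  have hinj : Function.Injective fun m : ℕ ↦ 2 * m := fun a b h ↦ by simpa using h
  rw [← hinj.hasSum_iff] at h
  · refine (congrArg₂ (HasSum · ·) (funext fun m ↦ ?_) ?_).mpr h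
    · simp only [Function.comp, Odd.neg_pow (⟨m, rfl⟩ : Odd (2 * m + 1))]
      push_cast
      ring
    · rw [sub_neg_eq_add]
      ring_nf
  · intro n hn
    have hev : Even (n + 1) := by
      rcases Nat.even_or_odd' n with ⟨m, rfl | rfl⟩
      · exact absurd ⟨m, rfl⟩ hn
      · exact ⟨m + 1, by ring⟩
    rw [hev.neg_pow, sub_self]

lemma one_sub_ofReal_pow_ne_zero {q : ℝ} (hq0 : 0 < q) (hq1 : q < 1) (m : ℕ) :
    (1 - (q : ℂ) ^ (2 * m + 1)) ≠ 0 := by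
  have : 0 < 1 - q ^ (2 * m + 1) := one_sub_pow_succ_pos hq0 hq1 (2 * m)
  exact_mod_cast this.ne'

lemma hasSum_log_lambertLog {q : ℝ} (hq0 : 0 < q) (hq1 : q < 1) {z : ℂ} (hz : ‖z‖ < 1) :
    HasSum (fun n : ℕ ↦ log (1 + z * q ^ n) - log (1 - z * q ^ n)) (lambertLog q z) := by
  have hq : ‖(q : ℂ)‖ < 1 := by rwa [norm_real, Real.norm_of_nonneg hq0.le]
  obtain ⟨F, hF⟩ : ∃ F : ℕ → ℕ → ℂ, ∀ n m,
      F n m = 2 * (z * (q : ℂ) ^ n) ^ (2 * m + 1) / (2 * m + 1) := ⟨_, fun _ _ ↦ rfl⟩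
  have hbound : Summable fun x : ℕ × ℕ ↦ ‖(q : ℂ)‖ ^ x.1 * (2 * ‖z‖ ^ x.2) :=
    (summable_geometric_of_lt_one (norm_nonneg _) hq).mul_of_nonneg
      ((summable_geometric_of_lt_one (norm_nonneg _) hz).mul_left 2)
      (fun _ ↦ by positivity) (fun _ ↦ by positivity)
  have hsum : Summable fun x : ℕ × ℕ ↦ F x.1 x.2 := by
    refine hbound.of_norm_bounded fun ⟨n, m⟩ ↦ ?_
    have h1 : ‖(2 * (m : ℂ) + 1)‖ = 2 * m + 1 := by
      rw [show (2 * (m : ℂ) + 1) = ((2 * m + 1 : ℝ) : ℂ) by push_cast; rfl, norm_real,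
        Real.norm_of_nonneg (by positivity)]
    simp only [hF]
    rw [norm_div, h1, norm_mul, norm_pow, norm_mul, norm_pow, mul_pow, ← pow_mul,
      Complex.norm_ofNat]
    calc _ ≤ 2 * (‖z‖ ^ (2 * m + 1) * ‖(q : ℂ)‖ ^ (n * (2 * m + 1))) :=
          div_le_self (by positivity) (by linarith [(Nat.cast_nonneg m : (0 : ℝ) ≤ m)])
      _ ≤ 2 * (‖z‖ ^ m * ‖(q : ℂ)‖ ^ n) := by
          gcongr 2 * (?_ * ?_)
          · exact pow_le_pow_of_le_one (norm_nonneg _) hz.le (by omega)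
          · exact pow_le_pow_of_le_one (norm_nonneg _) hq.le (by nlinarith)
      _ = _ := by ring
  have hrow (n : ℕ) : HasSum (fun m ↦ F n m)
      (log (1 + z * q ^ n) - log (1 - z * q ^ n)) := by
    simp only [hF]
    refine hasSum_log_one_add_sub_log_one_sub ?_
    rw [norm_mul, norm_pow]
    exact mul_lt_one_of_nonneg_of_lt_one_left (norm_nonneg _) hz
      (pow_le_one₀ (norm_nonneg _) hq.le)
  have hcol (m : ℕ) : HasSum (fun n ↦ F n m)
      (2 * z ^ (2 * m + 1) / ((2 * m + 1) * (1 - (q : ℂ) ^ (2 * m + 1)))) := by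
    have hqm : ‖(q : ℂ) ^ (2 * m + 1)‖ < 1 := by
      rw [norm_pow]; exact pow_lt_one₀ (norm_nonneg _) hq (by omega)
    have h := (hasSum_geometric_of_norm_lt_one hqm).mul_left (2 * z ^ (2 * m + 1) / (2 * m + 1))
    refine (congrArg₂ (HasSum · ·) (funext fun n ↦ ?_) ?_).mpr h
    · rw [hF, mul_pow, ← pow_mul, ← pow_mul, mul_comm n]
      ring
    · rw [div_mul_eq_div_div, div_eq_mul_inv _ (1 - _)]
  -- sum the double series in both orders
  have h1 := hsum.hasSum.prod_fiberwise hrow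
  have h2 := ((Equiv.prodComm ℕ ℕ).hasSum_iff.2 hsum.hasSum).prod_fiberwise
    (f := (fun x : ℕ × ℕ ↦ F x.1 x.2) ∘ Equiv.prodComm ℕ ℕ) hcol
  rwa [lambertLog, h2.tsum_eq]

lemma exp_lambertLog {q : ℝ} (hq0 : 0 < q) (hq1 : q < 1) {z : ℂ} (hz : ‖z‖ < 1) :
    cexp (lambertLog q z) = qPochInf (-z) q / qPochInf z q := by
  have hq : ‖(q : ℂ)‖ < 1 := by rwa [norm_real, Real.norm_of_nonneg hq0.le]
  rw [eq_div_iff (qPochInf_ne_zero hz hq)]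
  refine ((hasSum_log_lambertLog hq0 hq1 hz).cexp.mul (hasProd_qPochInf z hq)).unique ?_
  refine (congrArg (HasProd · _) (funext fun n ↦ ?_)).mpr (hasProd_qPochInf (-z) hq)
  have hzn : ‖z * (q : ℂ) ^ n‖ < 1 := by
    rw [norm_mul, norm_pow]
    exact mul_lt_one_of_nonneg_of_lt_one_left (norm_nonneg _) hz
      (pow_le_one₀ (norm_nonneg _) hq.le)
  have hne1 : 1 + z * (q : ℂ) ^ n ≠ 0 := fun h ↦ by
    rw [show z * (q : ℂ) ^ n = -1 by linear_combination h] at hzn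
    simp at hzn
  have hne2 : 1 - z * (q : ℂ) ^ n ≠ 0 := fun h ↦ by
    rw [show z * (q : ℂ) ^ n = 1 by linear_combination -h] at hzn
    simp at hzn
  simp only [Function.comp, Complex.exp_sub, Complex.exp_log hne1, Complex.exp_log hne2]
  rw [div_mul_cancel₀ _ hne2]
  ring

/-- Along the circle `z = A e^{icθ}` the series `lambertLog` may be differentiated termwise. -/
lemma hasDerivAt_lambertLog {q : ℝ} (hq0 : 0 < q) (hq1 : q < 1) {A : ℂ} (hA : ‖A‖ < 1) (c θ : ℝ) :
    HasSum (fun m : ℕ ↦ 2 * I * c * (A * cexp (I * (c * θ : ℝ))) ^ (2 * m + 1) /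
        (1 - (q : ℂ) ^ (2 * m + 1)))
      (deriv (fun θ : ℝ ↦ lambertLog q (A * cexp (I * (c * θ : ℝ)))) θ) ∧
    DifferentiableAt ℝ (fun θ : ℝ ↦ lambertLog q (A * cexp (I * (c * θ : ℝ)))) θ := by
  have hd (y : ℝ) : HasDerivAt (fun θ : ℝ ↦ A * cexp (I * (c * θ : ℝ)))
      (I * c * (A * cexp (I * (c * y : ℝ)))) y := by
    have h1 : HasDerivAt (fun θ : ℝ ↦ I * ((c * θ : ℝ) : ℂ)) (I * (c : ℂ)) y := by
      have := (((hasDerivAt_id y).const_mul c).ofReal_comp).const_mul I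
      simpa using this
    exact (h1.cexp.const_mul A).congr_deriv (by ring)
  have hnorm (y : ℝ) : ‖A * cexp (I * (c * y : ℝ))‖ = ‖A‖ := by
    rw [norm_mul, mul_comm I, norm_exp_ofReal_mul_I, mul_one]
  have hg (m : ℕ) (y : ℝ) : HasDerivAt
      (fun θ : ℝ ↦ 2 * (A * cexp (I * (c * θ : ℝ))) ^ (2 * m + 1) /
        ((2 * m + 1) * (1 - (q : ℂ) ^ (2 * m + 1))))
      (2 * I * c * (A * cexp (I * (c * y : ℝ))) ^ (2 * m + 1) / (1 - (q : ℂ) ^ (2 * m + 1))) y := by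
    have hm : (2 * (m : ℂ) + 1) ≠ 0 := by exact_mod_cast (2 * m).succ_ne_zero
    have hq := one_sub_ofReal_pow_ne_zero hq0 hq1 m
    refine ((((hd y).pow (2 * m + 1)).const_mul 2).div_const _).congr_deriv ?_
    push_cast
    field_simp
    ring
  have hlow (m : ℕ) : 1 - q ≤ ‖1 - (q : ℂ) ^ (2 * m + 1)‖ := by
    rw [show 1 - (q : ℂ) ^ (2 * m + 1) = ((1 - q ^ (2 * m + 1) : ℝ) : ℂ) by push_cast; rfl,
      norm_real, Real.norm_of_nonneg (one_sub_pow_succ_pos hq0 hq1 (2 * m)).le]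
    have := pow_le_of_le_one hq0.le hq1.le (n := 2 * m + 1) (by omega)
    linarith
  have hu : Summable fun m : ℕ ↦ ‖A‖ ^ m * (2 * |c| / (1 - q)) :=
    (summable_geometric_of_lt_one (norm_nonneg _) hA).mul_right _
  have hg' (m : ℕ) (y : ℝ) : ‖2 * I * c * (A * cexp (I * (c * y : ℝ))) ^ (2 * m + 1) /
      (1 - (q : ℂ) ^ (2 * m + 1))‖ ≤ ‖A‖ ^ m * (2 * |c| / (1 - q)) := by
    rw [norm_div, norm_mul, norm_pow, hnorm, norm_mul, norm_mul, norm_I, Complex.norm_ofNat,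
      norm_real, Real.norm_eq_abs, mul_one, ← mul_div_assoc, mul_comm (‖A‖ ^ m)]
    have := pow_le_pow_of_le_one (norm_nonneg A) hA.le (show m ≤ 2 * m + 1 by omega)
    have := sub_pos.2 hq1
    gcongr
    exact hlow m
  have hg0 : Summable fun m : ℕ ↦ 2 * (A * cexp (I * (c * θ : ℝ))) ^ (2 * m + 1) /
      ((2 * m + 1) * (1 - (q : ℂ) ^ (2 * m + 1))) := by
    refine ((summable_geometric_of_lt_one (norm_nonneg _) hA).mul_right
      (2 / (1 - q))).of_norm_bounded fun m ↦ ?_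
    have h1 : 1 ≤ ‖(2 * (m : ℂ) + 1)‖ := by
      rw [show (2 * (m : ℂ) + 1) = ((2 * m + 1 : ℝ) : ℂ) by push_cast; rfl, norm_real,
        Real.norm_of_nonneg (by positivity)]
      linarith [(Nat.cast_nonneg m : (0 : ℝ) ≤ m)]
    rw [norm_div, norm_mul, norm_pow, hnorm, Complex.norm_ofNat, norm_mul, ← mul_div_assoc,
      mul_comm (‖A‖ ^ m)]
    have := pow_le_pow_of_le_one (norm_nonneg A) hA.le (show m ≤ 2 * m + 1 by omega)
    have := sub_pos.2 hq1
    gcongr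
    nlinarith [hlow m]
  have h := hasDerivAt_tsum hu hg hg' hg0 θ
  have hs : Summable fun m : ℕ ↦ 2 * I * c * (A * cexp (I * (c * θ : ℝ))) ^ (2 * m + 1) /
      (1 - (q : ℂ) ^ (2 * m + 1)) := hu.of_norm_bounded fun m ↦ hg' m θ
  refine ⟨?_, h.differentiableAt⟩
  have h' : deriv (fun θ : ℝ ↦ lambertLog q (A * cexp (I * (c * θ : ℝ)))) θ = _ := h.deriv
  rw [h']
  exact hs.hasSum

/-- Two branches of the logarithm that are continuous at a point differ near it by a constant, so
that they have the same derivative there. -/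
lemma IsLogBranchAt.hasDerivAt {f L L₀ : ℝ → ℂ} {θ : ℝ} {d : ℂ} (hL : IsLogBranchAt f L θ)
    (h₀ : ∀ t, cexp (L₀ t) = f t) (hd : HasDerivAt L₀ d θ) : HasDerivAt L d θ := by
  obtain ⟨hc, he⟩ := hL
  have hcont : ContinuousAt (fun t ↦ (L t - L₀ t) - (L θ - L₀ θ)) θ :=
    (hc.sub hd.continuousAt).sub continuousAt_const
  have h0 : Tendsto (fun t ↦ (L t - L₀ t) - (L θ - L₀ θ)) (𝓝 θ) (𝓝 0) := by
    have := hcont.tendsto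
    rwa [sub_self] at this
  have hsmall : ∀ᶠ t in 𝓝 θ, ‖(L t - L₀ t) - (L θ - L₀ θ)‖ < 1 := by
    simpa using h0.eventually (Metric.ball_mem_nhds 0 one_pos)
  have hone {t : ℝ} (ht : cexp (L t) = f t) : cexp (L t - L₀ t) = 1 := by
    rw [Complex.exp_sub, ht, ← h₀, div_self (Complex.exp_ne_zero _)]
  refine (hd.add_const (L θ - L₀ θ)).congr_of_eventuallyEq ?_
  filter_upwards [he, hsmall] with t ht hs
  have h1 : cexp ((L t - L₀ t) - (L θ - L₀ θ)) = 1 := by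
    rw [Complex.exp_sub, hone ht, hone he.self_of_nhds, div_one]
  have him := (abs_le.1 ((abs_im_le_norm _).trans hs.le))
  have hlog := Complex.log_exp (x := (L t - L₀ t) - (L θ - L₀ θ))
    (by linarith [Real.pi_gt_three]) (by linarith [Real.pi_gt_three])
  rw [h1, Complex.log_one] at hlog
  linear_combination -hlog

end

/-! ### Evaluation of the quotient of `q`-products -/

lemma nome_pos (r : ℝ) : 0 < nome r := Real.exp_pos _

lemma nome_lt_one {r : ℝ} (hr : 0 < r) : nome r < 1 :=
  (exp_neg_pi_mul_pos_lt_one (Real.sqrt_pos.2 hr)).2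

lemma norm_aParam (r θ : ℝ) : ‖aParam r θ‖ = √(nome r) := by
  rw [aParam, norm_mul, norm_mul, Complex.norm_I, one_mul, mul_comm Complex.I,
    Complex.norm_exp_ofReal_mul_I, mul_one, Complex.norm_real,
    Real.norm_of_nonneg (Real.sqrt_nonneg _)]

lemma sqrt_nome_lt_one {r : ℝ} (hr : 0 < r) : √(nome r) < 1 :=
  (Real.sqrt_lt' one_pos).2 (by simpa using nome_lt_one hr)

lemma norm_aParam_lt_one {r : ℝ} (hr : 0 < r) (θ : ℝ) : ‖aParam r θ‖ < 1 := by
  rw [norm_aParam]; exact sqrt_nome_lt_one hr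

lemma exp_lambertLog_aParam {r : ℝ} (hr : 0 < r) (θ : ℝ) :
    Complex.exp (lambertLog (nome r) (aParam r θ)) = pochQuot r θ :=
  exp_lambertLog (nome_pos r) (nome_lt_one hr) (norm_aParam_lt_one hr θ)

lemma realTheta3_sq {t : ℝ} (ht : 0 < t) (y : ℝ) :
    realTheta3 (t / 2) y ^ 2 =
      realTheta3 t 0 * realTheta3 t (2 * y) + realTheta2 t 0 * realTheta2 t (2 * y) := by
  have ht2 : 0 < t / 2 := half_pos ht
  have h := theta3_sq y (I_mul_ofReal_im_pos ht2)
  rw [show 2 * (Complex.I * ((t / 2 : ℝ) : ℂ)) = Complex.I * t by push_cast; ring,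
    ← Complex.ofReal_zero, show 2 * (y : ℂ) = (2 * y : ℝ) by push_cast; rfl,
    ← ofReal_realTheta3 ht2, ← ofReal_realTheta3 ht, ← ofReal_realTheta3 ht,
    ← ofReal_realTheta2 ht, ← ofReal_realTheta2 ht] at h
  exact_mod_cast h

/-- The fourth power of the modulus of the quotient of `q`-products is `(1 - k sn)/(1 + k sn)`:
the squared moduli of the two products are values of theta functions at `τ/2`, whose squares are
combinations of theta functions at `τ`. -/
lemma norm_pochQuot_pow_four {r : ℝ} (hr : 0 < r) (x : ℝ) :
    ‖pochQuot r (thetaPeriod √r * x)‖ ^ 4 =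
      (1 - thetaModulus √r * thetaSn √r x) / (1 + thetaModulus √r * thetaSn √r x) := by
  have ht := Real.sqrt_pos.2 hr
  set t := √r with ht_def
  have ht2 : 0 < t / 2 := half_pos ht
  set p := Real.exp (-(π * (t / 2))) with hp
  have hp0 : 0 < p := Real.exp_pos _
  have hpq : p ^ 2 = nome r := by
    rw [hp, ← Real.exp_nat_mul, nome]
    congr 1
    push_cast
    ring
  have hps : √(nome r) = p := by rw [← hpq, Real.sqrt_sq hp0.le]
  have hω := (thetaPeriod_pos ht).ne'
  have ha : aParam r (thetaPeriod t * x) =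
      p * Complex.exp ((2 * π * (1 / 4 + x / 2) : ℝ) * Complex.I) := by
    rw [aParam, hps, periodK_eq hr, ← ht_def,
      show π * (thetaPeriod t * x) / (2 * (thetaPeriod t / 2)) = π * x by field_simp,
      show ((2 * π * (1 / 4 + x / 2) : ℝ) : ℂ) * Complex.I =
        (π / 2) * Complex.I + Complex.I * (π * x : ℝ) by push_cast; ring,
      Complex.exp_add, Complex.exp_pi_div_two_mul_I]
    ring
  have ha' : -aParam r (thetaPeriod t * x) =
      p * Complex.exp ((2 * π * (1 / 4 + x / 2 + 1 / 2) : ℝ) * Complex.I) := by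
    rw [ha, show ((2 * π * (1 / 4 + x / 2 + 1 / 2) : ℝ) : ℂ) * Complex.I =
        ((2 * π * (1 / 4 + x / 2) : ℝ) : ℂ) * Complex.I + π * Complex.I by push_cast; ring,
      Complex.exp_add, Complex.exp_pi_mul_I]
    ring
  have hm : ‖qPochInf (-aParam r (thetaPeriod t * x)) (nome r)‖ ^ 2 * eulerLimit (p ^ 2) =
      realTheta3 (t / 2) (1 / 4 + x / 2) := by
    rw [realTheta3, theta3_ofReal ht2 _ hp, Complex.ofReal_re, ← ha, hpq, mul_comm]
  have hn : ‖qPochInf (aParam r (thetaPeriod t * x)) (nome r)‖ ^ 2 * eulerLimit (p ^ 2) =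
      realTheta3 (t / 2) (1 / 4 + x / 2 + 1 / 2) := by
    rw [realTheta3, theta3_ofReal ht2 _ hp, Complex.ofReal_re, ← ha', hpq, mul_comm, neg_neg]
  have hE : eulerLimit (p ^ 2) ≠ 0 :=
    (eulerLimit_pos (by positivity) (hpq ▸ nome_lt_one hr)).ne'
  have sm := realTheta3_sq ht (1 / 4 + x / 2)
  have sn := realTheta3_sq ht (1 / 4 + x / 2 + 1 / 2)
  have e3 : realTheta3 t (x + 1 / 2 + 1) = realTheta3 t (x + 1 / 2) := by
    rw [realTheta3, realTheta3, theta3, theta3, ← jacobiTheta₂_add_left ((x + 1 / 2 : ℝ) : ℂ)]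
    push_cast
    rfl
  have e2 : realTheta2 t (x + 1 / 2 + 1) = -realTheta2 t (x + 1 / 2) := by
    rw [realTheta2, realTheta2, ← Complex.neg_re, ← theta2_add_one]
    push_cast
    rfl
  rw [show 2 * (1 / 4 + x / 2) = x + 1 / 2 by ring, realTheta2_add_half, ← realTheta4_eq t x,
    ← hm] at sm
  rw [show 2 * (1 / 4 + x / 2 + 1 / 2) = x + 1 / 2 + 1 by ring, e3, e2, realTheta2_add_half,
    ← realTheta4_eq t x, ← hn] at sn
  have hq := qPochInf_ne_zero (norm_aParam_lt_one hr (thetaPeriod t * x))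
    (q := nome r) (by rw [Complex.norm_real, Real.norm_of_nonneg (nome_pos r).le]
                      exact nome_lt_one hr)
  have hq' : ‖qPochInf (aParam r (thetaPeriod t * x)) (nome r)‖ ≠ 0 := norm_ne_zero_iff.2 hq
  have a0 := (realTheta3_pos ht 0).ne'
  have b0 := (realTheta2_zero_pos ht).ne'
  have d0 := (realTheta4_pos ht x).ne'
  have hks : thetaModulus t * thetaSn t x =
      realTheta2 t 0 * realTheta1 t x / (realTheta3 t 0 * realTheta4 t x) := by
    rw [thetaModulus, thetaSn]
    field_simp
  have hden : realTheta3 t 0 * realTheta4 t x + realTheta2 t 0 * realTheta1 t x ≠ 0 := by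
    have : realTheta3 t 0 * realTheta4 t x + realTheta2 t 0 * realTheta1 t x =
      (‖qPochInf (aParam r (thetaPeriod t * x)) (nome r)‖ ^ 2 * eulerLimit (p ^ 2)) ^ 2 := by
      rw [sn]; ring
    rw [this]
    positivity
  have hfrac : (1 - thetaModulus t * thetaSn t x) / (1 + thetaModulus t * thetaSn t x) =
      (realTheta3 t 0 * realTheta4 t x - realTheta2 t 0 * realTheta1 t x) /
        (realTheta3 t 0 * realTheta4 t x + realTheta2 t 0 * realTheta1 t x) := by
    rw [hks, one_sub_div (mul_ne_zero a0 d0), one_add_div (mul_ne_zero a0 d0),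
      div_div_div_cancel_right₀ (mul_ne_zero a0 d0)]
  rw [hfrac, pochQuot, norm_div, div_pow, div_eq_div_iff (pow_ne_zero 4 hq') hden]
  refine mul_right_cancel₀ (pow_ne_zero 2 hE) ?_
  set u := ‖qPochInf (-aParam r (thetaPeriod t * x)) (nome r)‖
  set v := ‖qPochInf (aParam r (thetaPeriod t * x)) (nome r)‖
  linear_combination (realTheta3 t 0 * realTheta4 t x + realTheta2 t 0 * realTheta1 t x) * sm -
    (realTheta3 t 0 * realTheta4 t x - realTheta2 t 0 * realTheta1 t x) * sn

lemma one_add_sub_thetaModulus_mul_thetaSn_pos {t : ℝ} (ht : 0 < t) (x : ℝ) :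
    0 < 1 + thetaModulus t * thetaSn t x ∧ 0 < 1 - thetaModulus t * thetaSn t x := by
  have h : (thetaModulus t * thetaSn t x) ^ 2 < 1 := by
    have h1 := thetaDn_sq ht x
    have h2 := pow_pos (thetaDn_pos ht x) 2
    nlinarith
  have := abs_lt.1 ((sq_lt_one_iff_abs_lt_one _).1 h)
  exact ⟨by linarith, by linarith⟩

/-- The derivative of the real part of the logarithm is `-(k/2) cd`, because its fourfold is
`log (1 - k sn) - log (1 + k sn)`. -/
lemma deriv_lambertLog_re {r : ℝ} (hr : 0 < r) {L : ℝ → ℂ}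
    (hL : ∀ t, Complex.exp (L t) = pochQuot r t) {θ : ℝ} (hd : DifferentiableAt ℝ L θ) :
    2 * (deriv L θ).re = -(singularModulus r * ellCD r θ) := by
  have ht := Real.sqrt_pos.2 hr
  have hω := (thetaPeriod_pos ht).ne'
  have hk := singularModulus_eq hr
  set t := √r with ht_def
  obtain ⟨x, rfl⟩ : ∃ x, θ = thetaPeriod t * x := ⟨θ / thetaPeriod t, by field_simp⟩
  have hLx : HasDerivAt (fun y ↦ 4 * (L (thetaPeriod t * y)).re)
      (4 * (thetaPeriod t * (deriv L (thetaPeriod t * x)).re)) x := by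
    have h1 : HasDerivAt (fun y ↦ thetaPeriod t * y) (thetaPeriod t) x := by
      simpa using (hasDerivAt_id x).const_mul (thetaPeriod t)
    have h2 := Complex.reCLM.hasFDerivAt.comp_hasDerivAt x (hd.hasDerivAt.scomp x h1)
    have h3 := h2.const_mul 4
    simpa using h3
  have hlog (y : ℝ) : 4 * (L (thetaPeriod t * y)).re =
      Real.log (1 - thetaModulus t * thetaSn t y) -
        Real.log (1 + thetaModulus t * thetaSn t y) := by
    obtain ⟨hp, hm⟩ := one_add_sub_thetaModulus_mul_thetaSn_pos ht y
    rw [← Real.log_div hm.ne' hp.ne', ← norm_pochQuot_pow_four hr, ← hL, Complex.norm_exp,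
      ← Real.exp_nat_mul, Real.log_exp, ← ht_def]
    norm_num
  obtain ⟨hp, hm⟩ := one_add_sub_thetaModulus_mul_thetaSn_pos ht x
  have hS := (hasDerivAt_thetaSn ht x).const_mul (thetaModulus t)
  have hR := ((hS.const_sub 1).log hm.ne').sub ((hS.const_add 1).log hp.ne')
  have h := hLx.unique (hR.congr_of_eventuallyEq (Eventually.of_forall hlog))
  have hD := (thetaDn_pos ht x).ne'
  rw [ellCD, hk, jacobiCn_thetaPeriod_mul ht, jacobiDn_thetaPeriod_mul ht]
  have hD2 := thetaDn_sq ht x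
  have hprod : (1 - thetaModulus t * thetaSn t x) * (1 + thetaModulus t * thetaSn t x) =
      thetaDn t x ^ 2 := by rw [hD2]; ring
  have h' : 4 * (thetaPeriod t * (deriv L (thetaPeriod t * x)).re) * thetaDn t x ^ 2 =
      -2 * thetaModulus t * (thetaPeriod t * thetaCn t x * thetaDn t x) := by
    rw [h, ← hprod]
    field_simp
    ring
  refine mul_left_cancel₀ (mul_ne_zero (mul_ne_zero hω hD) hD) ?_
  field_simp
  refine mul_left_cancel₀ (mul_ne_zero hω hD) ?_
  linear_combination (1 / 2) * h'

/-- Real and imaginary part of the logarithmic derivative as Lambert series, combined into `cd₁`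
by the addition theorem for `cos ((2n + 1)x + 2x)`. -/
lemma ellCD1_eq_deriv {r : ℝ} (hr : 0 < r) (θ : ℝ) :
    singularModulus r * ellCD1 r θ =
      -2 * (deriv (fun t ↦ lambertLog (nome r) (aParam r t)) θ).re * Real.cos (π * θ / periodK r) +
      2 * (deriv (fun t ↦ lambertLog (nome r) (aParam r t)) θ).im *
        Real.sin (π * θ / periodK r) := by
  have ht := Real.sqrt_pos.2 hr
  have hk : singularModulus r ≠ 0 := by
    rw [singularModulus_eq hr]; exact (thetaModulus_pos ht).ne'
  have hK : periodK r ≠ 0 := by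
    rw [periodK_eq hr]; exact (half_pos (thetaPeriod_pos ht)).ne'
  have hq0 := nome_pos r
  have hq1 := nome_lt_one hr
  set q := nome r with hq
  set c := π / (2 * periodK r) with hc
  have ha (y : ℝ) : aParam r y =
      Complex.I * ((√q : ℝ) : ℂ) * Complex.exp (Complex.I * (c * y : ℝ)) := by
    rw [aParam, hc, div_mul_eq_mul_div]
  have hA : ‖Complex.I * ((√q : ℝ) : ℂ)‖ < 1 := by
    rw [norm_mul, Complex.norm_I, one_mul, Complex.norm_real,
      Real.norm_of_nonneg (Real.sqrt_nonneg _)]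
    exact sqrt_nome_lt_one hr
  have h := (hasDerivAt_lambertLog hq0 hq1 hA c θ).1
  simp only [← ha] at h
  set d := deriv (fun t ↦ lambertLog q (aParam r t)) θ with hd
  have hterm (m : ℕ) : 2 * Complex.I * c * aParam r θ ^ (2 * m + 1) /
      (1 - (q : ℂ) ^ (2 * m + 1)) =
      ((-(2 * c) * ((-1) ^ m * q ^ ((m : ℝ) + 1 / 2) / (1 - q ^ (2 * m + 1))) : ℝ) : ℂ) *
        Complex.exp (((2 * m + 1) * (c * θ) : ℝ) * Complex.I) := by
    have e1 : q ^ ((m : ℝ) + 1 / 2) = √q ^ (2 * m + 1) := by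
      rw [Real.sqrt_eq_rpow, ← Real.rpow_natCast, ← Real.rpow_mul hq0.le]
      congr 1
      push_cast
      ring
    have e2 : Complex.exp (Complex.I * (c * θ : ℝ)) ^ (2 * m + 1) =
        Complex.exp (((2 * m + 1) * (c * θ) : ℝ) * Complex.I) := by
      rw [← Complex.exp_nat_mul]
      congr 1
      push_cast
      ring
    have e3 : Complex.I ^ (2 * m + 1) = (-1) ^ m * Complex.I := by
      rw [pow_succ, pow_mul, Complex.I_sq]
    rw [ha, mul_pow, mul_pow, e2, e3, e1]
    push_cast
    linear_combination (2 * c * (-1) ^ m * (√q : ℂ) ^ (2 * m + 1) *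
      Complex.exp ((2 * m + 1) * (c * θ) * Complex.I) / (1 - (q : ℂ) ^ (2 * m + 1))) *
      Complex.I_sq
  simp only [hterm] at h
  have hre := Complex.hasSum_re h
  have him := Complex.hasSum_im h
  simp only [Complex.re_ofReal_mul, Complex.im_ofReal_mul, Complex.exp_ofReal_mul_I_re,
    Complex.exp_ofReal_mul_I_im] at hre him
  have hsum := ((hre.mul_right (-2 * Real.cos (π * θ / periodK r))).add
    (him.mul_right (2 * Real.sin (π * θ / periodK r)))).tsum_eq
  rw [ellCD1, ← tsum_mul_left, ← tsum_mul_left]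
  calc _ = _ := tsum_congr fun m ↦ ?_
    _ = _ := hsum
    _ = _ := by ring
  have hcos : Real.cos ((2 * m + 3) * c * θ) =
      Real.cos ((2 * m + 1) * (c * θ)) * Real.cos (π * θ / periodK r) -
        Real.sin ((2 * m + 1) * (c * θ)) * Real.sin (π * θ / periodK r) := by
    rw [← Real.cos_add]
    congr 1
    rw [hc]
    field_simp
    ring
  rw [hcos, hc]
  field_simp
  ring

theorem theorem13 (r : ℝ) (hr : 0 < r) :
    (∀ θ : ℝ,
      pochP r θ ≠ 0 ∧
      0 < ellND r θ + singularModulus r * ellSD r θ ∧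
      (Complex.log (pochP r θ)).re
        = -Real.log (ellND r θ + singularModulus r * ellSD r θ) ∧
      (pochP r θ ≠ -1 →
        (Complex.log (-1 + 2 / (1 - uZero r θ))).re
          = -Real.log (ellND r θ + singularModulus r * ellSD r θ))) ∧
    (∃ L : ℝ → ℂ, Continuous L ∧ ∀ t : ℝ, Complex.exp (L t) = pochQuot r t) ∧
    (∀ (θ : ℝ) (L : ℝ → ℂ), IsLogBranchAt (pochQuot r) L θ →
      DifferentiableAt ℝ L θ ∧
      ellCD1 r θ
        = ellCD r θ * Real.cos (Real.pi * θ / periodK r)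
          + 2 * (singularModulus r)⁻¹ * Real.sin (Real.pi * θ / periodK r)
            * (deriv L θ).im) := by
  have ht := Real.sqrt_pos.2 hr
  have hexp := exp_lambertLog_aParam hr
  have hdiff (θ : ℝ) : DifferentiableAt ℝ (fun t ↦ lambertLog (nome r) (aParam r t)) θ := by
    have hA : ‖Complex.I * ((√(nome r) : ℝ) : ℂ)‖ < 1 := by
      rw [norm_mul, Complex.norm_I, one_mul, Complex.norm_real,
        Real.norm_of_nonneg (Real.sqrt_nonneg _)]
      exact sqrt_nome_lt_one hr
    have h := (hasDerivAt_lambertLog (nome_pos r) (nome_lt_one hr) hA (π / (2 * periodK r)) θ).2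
    simp only [div_mul_eq_mul_div] at h
    exact h
  refine ⟨fun θ ↦ ?_, ⟨_, continuous_iff_continuousAt.2 fun θ ↦ (hdiff θ).continuousAt, hexp⟩,
    fun θ L hL ↦ ?_⟩
  · have hω := (thetaPeriod_pos ht).ne'
    have hP0 : pochP r θ ≠ 0 := by
      rw [pochP, ← hexp]
      exact pow_ne_zero 2 (Complex.exp_ne_zero _)
    obtain ⟨x, rfl⟩ : ∃ x, θ = thetaPeriod √r * x := ⟨θ / thetaPeriod √r, by field_simp⟩
    obtain ⟨hp, hm⟩ := one_add_sub_thetaModulus_mul_thetaSn_pos ht x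
    have hD := thetaDn_pos ht x
    have hsum : ellND r (thetaPeriod √r * x) + singularModulus r * ellSD r (thetaPeriod √r * x) =
        (1 + thetaModulus √r * thetaSn √r x) / thetaDn √r x := by
      rw [ellND, ellSD, singularModulus_eq hr, jacobiDn_thetaPeriod_mul ht,
        jacobiSn_thetaPeriod_mul ht]
      ring
    have hlog : (Complex.log (pochP r (thetaPeriod √r * x))).re =
        -Real.log (ellND r (thetaPeriod √r * x) +
          singularModulus r * ellSD r (thetaPeriod √r * x)) := by
      have hsq : ‖pochP r (thetaPeriod √r * x)‖ ^ 2 =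
          (((1 + thetaModulus √r * thetaSn √r x) / thetaDn √r x) ^ 2)⁻¹ := by
        rw [pochP, norm_pow, ← pow_mul, norm_pochQuot_pow_four hr, div_pow, thetaDn_sq ht, inv_div,
          div_eq_div_iff hp.ne' (pow_pos hp 2).ne']
        ring
      have h2 := congrArg Real.log hsq
      rw [Real.log_pow, Real.log_inv, Real.log_pow] at h2
      rw [Complex.log_re, hsum]
      push_cast at h2
      linarith
    refine ⟨hP0, hsum ▸ div_pos hp hD, hlog, fun hP1 ↦ ?_⟩
    have hne : pochP r (thetaPeriod √r * x) + 1 ≠ 0 := fun h ↦ hP1 (eq_neg_of_add_eq_zero_left h)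
    have hu : -1 + 2 / (1 - uZero r (thetaPeriod √r * x)) = pochP r (thetaPeriod √r * x) := by
      rw [uZero, one_sub_div hne]
      field_simp
      ring
    rw [hu, hlog]
  · have hd := hL.hasDerivAt hexp (hdiff θ).hasDerivAt
    refine ⟨hd.differentiableAt, ?_⟩
    have hk : singularModulus r ≠ 0 := by
      rw [singularModulus_eq hr]; exact (thetaModulus_pos ht).ne'
    have h1 := ellCD1_eq_deriv hr θ
    have h2 := deriv_lambertLog_re hr hexp (hdiff θ)
    rw [hd.deriv]
    refine mul_left_cancel₀ hk ?_
    linear_combination h1 - Real.cos (π * θ / periodK r) * h2 -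
      2 * (deriv (fun t ↦ lambertLog (nome r) (aParam r t)) θ).im *
        Real.sin (π * θ / periodK r) * mul_inv_cancel₀ hk

end
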